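/- Let $M$ be a compact smooth $n$-manifold without boundary, let $\mathcal M$ be the space of smooth Riemannian metrics on $M$ (an open convex cone in the Fréchet space $\Gamma(S^2T^*M)$ of smooth symmetric $(0,2)$-tensor fields, so that $T_g\mathcal M=\Gamma(S^2T^*M)$), and let $$g_E(h,k)|_g=\int_M \mathrm{tr}(g^{-1}hg^{-1}k)\,dV_g,\qquad V=V_g=\int_M dV_g,\qquad g_p=V^{-p}g_E\quad(p\in\mathbb R).$$ Write $(h,k)_p=g_p(h,k)$, and let $g^{\flat_p}=(g,\cdot)_p$ be the 1-form dual with respect to $g_p$ to the tautological vector field $g\mapsto g$ on $\mathcal M$. For a Riemannian metric $G$ on $\mathcal M$ with Levi-Civita connection $\nabla$ put $R(X,Y)Z=\nabla_X\nabla_YZ-\nabla_Y\nabla_XZ-\nabla_{[X,Y]}Z$, $R^G(a,b,c,d)=G(R(a,b)c,d)$ and $\mathrm{sec}^G(h,k)=G(R(h,k)k,h)$ (without normalization). For bilinear forms $A,B$ let $$(A\odot B)(a,b,c,d)=A(a,c)B(b,d)+A(b,d)B(a,c)-A(a,d)B(b,c)-A(b,c)B(a,d)$$ be the Kulkarni–Nomizu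 product. Then $g_E$ and $g_p$ have Levi-Civita connections, and at every $g\in\mathcal M$ $$R^{g_p}=V^{-p}R^{g_E}+\frac{2p-p^2}{16}\,g_p\odot\Big(V^{2p-2}\,g^{\flat_p}\otimes g^{\flat_p}-\frac n2V^{p-1}g_p\Big).$$ If $h,k\in T_g\mathcal M$ are orthonormal with respect to $g_p$, then the $g_p$-sectional curvature of the plane spanned by $h$ and $k$ is $\mathrm{sec}^{g_p}(h,k)$, and $$\mathrm{sec}^{g_p}(h,k)=V^{-p}\,\mathrm{sec}^{g_E}(h,k)-\frac{2p-p^2}{16}\Big(V^{2p-2}(g,k)_p^2+V^{2p-2}(g,h)_p^2-nV^{p-1}\Big).$$ -/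

import Mathlib

open scoped Manifold ContDiff Topology Bundle

noncomputable section

namespace SpaceOfMetrics

/-! ## Symmetric tensor fields and Riemannian metrics on a closed manifold -/

section Tensors

variable (n : ℕ) (M : Type*) [TopologicalSpace M]
  [ChartedSpace (EuclideanSpace ℝ (Fin n)) M] [IsManifold (𝓡 n) ∞ M]

/-- A shortcut for instance search. -/
instance continuousAdd_cotangent (x : M) : ContinuousAdd (TangentSpace (𝓡 n) x →L[ℝ] ℝ) :=
  IsTopologicalAddGroup.toContinuousAdd

/-- Smooth sections of `T*M ⊗ T*M`, i.e. smooth fields of bilinear forms on `M`. -/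
abbrev BilinSection :=
  ContMDiffSection (𝓡 n)
    (EuclideanSpace ℝ (Fin n) →L[ℝ] EuclideanSpace ℝ (Fin n) →L[ℝ] ℝ) ∞
    (fun x : M => TangentSpace (𝓡 n) x →L[ℝ] TangentSpace (𝓡 n) x →L[ℝ] ℝ)

instance : AddCommGroup (BilinSection n M) := ContMDiffSection.instAddCommGroup

instance : Module ℝ (BilinSection n M) := ContMDiffSection.instModule

/-- The vector space `Γ(S²T*M)` of smooth symmetric `(0,2)`-tensor fields on `M`. -/
def symTensors : Submodule ℝ (BilinSection n M) where
  carrier := {s | ∀ (x : M) (v w : TangentSpace (𝓡 n) x), s x v w = s x w v}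
  add_mem' := by
    intro a b ha hb x v w
    have h1 := ha x v w
    have h2 := hb x v w
    simp only [ContMDiffSection.coe_add, Pi.add_apply, add_apply, h1, h2]
  zero_mem' := by
    intro x v w
    simp
  smul_mem' := by
    intro c a ha x v w
    have h1 := ha x v w
    simp only [ContMDiffSection.coe_smul, Pi.smul_apply, smul_apply, h1]

/-- `Γ(S²T*M)` as a type. -/
def SymTensor : Type _ := ↥(symTensors n M)

instance : AddCommGroup (SymTensor n M) :=
  Submodule.addCommGroup (symTensors n M)

instance : Module ℝ (SymTensor n M) :=
  Submodule.module (symTensors n M)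

/-- `s x v w` is the value of the tensor field `s` at the point `x` on the vectors `v` and `w`. -/
instance : CoeFun (SymTensor n M)
    (fun _ => ∀ x : M, TangentSpace (𝓡 n) x →L[ℝ] TangentSpace (𝓡 n) x →L[ℝ] ℝ) :=
  ⟨fun s x => s.1 x⟩

/-- The space of all smooth Riemannian metrics on `M`, an open convex cone in `Γ(S²T*M)`.
Its tangent space at each point is `Γ(S²T*M)`. -/
def metrics : Set (SymTensor n M) :=
  {g | ∀ (x : M) (v : TangentSpace (𝓡 n) x), v ≠ 0 → 0 < g x v v}

end Tensors

section Geometry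

variable {n : ℕ} {M : Type*} [TopologicalSpace M]
  [ChartedSpace (EuclideanSpace ℝ (Fin n)) M] [IsManifold (𝓡 n) ∞ M]

/-- The endomorphism `g⁻¹ h` of `T_x M`, i.e. the `(1,1)`-tensor dual to `h` with respect to `g`;
here `g` and `h` are read as maps `T_x M → T_x* M`. -/
def sharp (g h : SymTensor n M) (x : M) : TangentSpace (𝓡 n) x →L[ℝ] TangentSpace (𝓡 n) x :=
  (ContinuousLinearMap.inverse (g x)).comp (h x)

/-- The function `x ↦ tr (g⁻¹ h g⁻¹ k)`. -/
def trPair (g h k : SymTensor n M) (x : M) : ℝ :=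
  LinearMap.trace ℝ (TangentSpace (𝓡 n) x)
    (((sharp g h x).comp (sharp g k x) :
      TangentSpace (𝓡 n) x →L[ℝ] TangentSpace (𝓡 n) x) :
      TangentSpace (𝓡 n) x →ₗ[ℝ] TangentSpace (𝓡 n) x)

/-! ## Integration against the Riemannian volume density -/

/-- The `a`-th coordinate vector field of the preferred chart at `i`, at a point `x` of the
domain of that chart (the derivative of the inverse chart applied to the `a`-th basis vector). -/
def coordVec (i x : M) (a : Fin n) : TangentSpace (𝓡 n) x :=
  (trivializationAt (EuclideanSpace ℝ (Fin n)) (TangentSpace (𝓡 n) (M := M)) i).symmL ℝ x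
    (EuclideanSpace.single a (1 : ℝ))

/-- The matrix `(g_ab)` of `g` at `x` in the coordinates of the preferred chart at `i`. -/
def gramMatrix (g : SymTensor n M) (i x : M) : Matrix (Fin n) (Fin n) ℝ :=
  Matrix.of fun a b => g x (coordVec i x a) (coordVec i x b)

variable (n M) in
/-- A smooth partition of unity on `M` subordinate to the domains of the preferred charts. It is
fixed once and for all; the integral defined below does not depend on it, by the change of
variables formula. -/
def chartPartition [CompactSpace M] [T2Space M] :
    SmoothPartitionOfUnity M (𝓡 n) M Set.univ :=
  (SmoothPartitionOfUnity.exists_isSubordinate_chartAt_source (𝓡 n) M).choose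

/-- The integral `∫_M f dV_g`, in local coordinates
`∑ᵢ ∫ ρᵢ f √(det (g_ab)) dy` with a partition of unity `ρ` subordinate to coordinate charts
(`M` need not be orientable: `dV_g` is the volume density). -/
def volIntegral [CompactSpace M] [T2Space M] (g : SymTensor n M) (f : M → ℝ) : ℝ :=
  ∑ᶠ i : M, ∫ y in (extChartAt (𝓡 n) i).target,
    chartPartition n M i ((extChartAt (𝓡 n) i).symm y) * f ((extChartAt (𝓡 n) i).symm y) *
      Real.sqrt (gramMatrix g i ((extChartAt (𝓡 n) i).symm y)).det

/-- The total volume `V_g = ∫_M dV_g`. -/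
def vol [CompactSpace M] [T2Space M] (g : SymTensor n M) : ℝ := volIntegral g fun _ => 1

/-- The Ebin metric `g_E(h,k)|_g = ∫_M tr (g⁻¹ h g⁻¹ k) dV_g`. -/
def ebin [CompactSpace M] [T2Space M] (g h k : SymTensor n M) : ℝ := volIntegral g (trPair g h k)

/-- The metric `g_p = V^{-p} g_E` on the space of metrics. -/
def ebinP [CompactSpace M] [T2Space M] (p : ℝ) (g h k : SymTensor n M) : ℝ := vol g ^ (-p) * ebin g h k


/-! ## Calculus on the space of metrics

Smoothness is understood in the sense of the convenient calculus, which on the Fréchet space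
`Γ(S²T*M)` is the usual smoothness: a curve in `Γ(S²T*M)` is smooth iff it is jointly smooth in
time and in the point of `M`, and a map is smooth iff it sends smooth curves to smooth curves.
The derivative of a smooth curve of sections is its pointwise derivative. -/

/-- Smooth curves in `Γ(S²T*M)`. -/
def IsSmoothCurve (c : ℝ → SymTensor n M) : Prop :=
  ContMDiff (𝓘(ℝ, ℝ).prod (𝓡 n))
    ((𝓡 n).prod 𝓘(ℝ, EuclideanSpace ℝ (Fin n) →L[ℝ] EuclideanSpace ℝ (Fin n) →L[ℝ] ℝ)) ∞
    (fun q : ℝ × M =>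
      (Bundle.TotalSpace.mk'
        (EuclideanSpace ℝ (Fin n) →L[ℝ] EuclideanSpace ℝ (Fin n) →L[ℝ] ℝ) q.2 (c q.1 q.2) :
        Bundle.TotalSpace (EuclideanSpace ℝ (Fin n) →L[ℝ] EuclideanSpace ℝ (Fin n) →L[ℝ] ℝ)
          (fun x : M => TangentSpace (𝓡 n) x →L[ℝ] TangentSpace (𝓡 n) x →L[ℝ] ℝ)))

/-- `s` is the derivative at `t = 0` of `X (g + t h)`. -/
def HasDirDeriv (X : SymTensor n M → SymTensor n M) (g h s : SymTensor n M) : Prop :=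
  ∀ (x : M) (v w : TangentSpace (𝓡 n) x),
    HasDerivAt (fun t : ℝ => X (g + t • h) x v w) (s x v w) 0

open Classical in
/-- The directional derivative `D_h X |_g = d/dt|_{t=0} X (g + t h)` of a vector field `X`
(with value `0` if it does not exist; it exists for smooth `X`). -/
def dirDeriv (X : SymTensor n M → SymTensor n M) (g h : SymTensor n M) : SymTensor n M :=
  if H : ∃ s, HasDirDeriv X g h s then H.choose else 0

/-- `C` is the Christoffel map of the Levi-Civita connection `∇_X Y = D_X Y + C(X, Y)` of the
(weak) Riemannian metric `G` on the space of metrics: it is bilinear, depends smoothly on its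
arguments, and the connection is torsion free and metric. The last two properties are
expressed with constant vector fields, for which `∇_h k |_g = C g h k`. Only the values of `C`
at `g` in the space of metrics matter. -/
structure IsLeviCivita (G : SymTensor n M → SymTensor n M → SymTensor n M → ℝ)
    (C : SymTensor n M → SymTensor n M →ₗ[ℝ] SymTensor n M →ₗ[ℝ] SymTensor n M) : Prop where
  smooth : ∀ c a b : ℝ → SymTensor n M, IsSmoothCurve c → IsSmoothCurve a → IsSmoothCurve b →
    (∀ t, c t ∈ metrics n M) → IsSmoothCurve fun t => C (c t) (a t) (b t)
  torsion_free : ∀ g ∈ metrics n M, ∀ h k : SymTensor n M, C g h k = C g k h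
  metric : ∀ g ∈ metrics n M, ∀ h k l : SymTensor n M,
    HasDerivAt (fun t : ℝ => G (g + t • h) k l) (G g (C g h k) l + G g k (C g h l)) 0

/-- The covariant derivative `∇_X Y` of vector fields. -/
def covDeriv (C : SymTensor n M → SymTensor n M →ₗ[ℝ] SymTensor n M →ₗ[ℝ] SymTensor n M)
    (X Y : SymTensor n M → SymTensor n M) : SymTensor n M → SymTensor n M :=
  fun g => dirDeriv Y g (X g) + C g (X g) (Y g)

/-- The Lie bracket `[X, Y] = D_X Y - D_Y X` of vector fields. -/
def bracket (X Y : SymTensor n M → SymTensor n M) : SymTensor n M → SymTensor n M :=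
  fun g => dirDeriv Y g (X g) - dirDeriv X g (Y g)

/-- `R(X,Y)Z = ∇_X ∇_Y Z - ∇_Y ∇_X Z - ∇_{[X,Y]} Z` for vector fields. -/
def curvField (C : SymTensor n M → SymTensor n M →ₗ[ℝ] SymTensor n M →ₗ[ℝ] SymTensor n M)
    (X Y Z : SymTensor n M → SymTensor n M) : SymTensor n M → SymTensor n M :=
  fun g => covDeriv C X (covDeriv C Y Z) g - covDeriv C Y (covDeriv C X Z) g
    - covDeriv C (bracket X Y) Z g

/-- The curvature `R(h,k)l` at `g` for tangent vectors `h, k, l`, which are extended to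
constant vector fields. -/
def curvOp (C : SymTensor n M → SymTensor n M →ₗ[ℝ] SymTensor n M →ₗ[ℝ] SymTensor n M)
    (g h k l : SymTensor n M) : SymTensor n M :=
  curvField C (fun _ => h) (fun _ => k) (fun _ => l) g

/-- The `(0,4)` curvature tensor `R(h,k,l,m) = G(R(h,k)l, m)` at `g`. -/
def curv (G : SymTensor n M → SymTensor n M → SymTensor n M → ℝ)
    (C : SymTensor n M → SymTensor n M →ₗ[ℝ] SymTensor n M →ₗ[ℝ] SymTensor n M)
    (g h k l m : SymTensor n M) : ℝ :=
  G g (curvOp C g h k l) m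

/-- `sec(h,k) = G(R(h,k)k, h)` (no normalization). -/
def sec (G : SymTensor n M → SymTensor n M → SymTensor n M → ℝ)
    (C : SymTensor n M → SymTensor n M →ₗ[ℝ] SymTensor n M →ₗ[ℝ] SymTensor n M)
    (g h k : SymTensor n M) : ℝ :=
  curv G C g h k k h

/-- The sectional curvature of the plane spanned by `h` and `k`. -/
def planeCurv (G : SymTensor n M → SymTensor n M → SymTensor n M → ℝ)
    (C : SymTensor n M → SymTensor n M →ₗ[ℝ] SymTensor n M →ₗ[ℝ] SymTensor n M)
    (g h k : SymTensor n M) : ℝ :=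
  sec G C g h k / (G g h h * G g k k - G g h k ^ 2)

/-- The Kulkarni-Nomizu product of two bilinear forms. -/
def kulkarniNomizu {E : Type*} (A B : E → E → ℝ) (a b c d : E) : ℝ :=
  A a c * B b d + A b d * B a c - A a d * B b c - A b c * B a d

/-- The value at `g` of the 1-form dual, with respect to `g_p`, to the tautological vector
field `g ↦ g`. -/
def flatP [CompactSpace M] [T2Space M] (p : ℝ) (g h : SymTensor n M) : ℝ := ebinP p g g h

end Geometry

end SpaceOfMetrics

end

open SpaceOfMetrics

/-! `g_p` is a conformal rescaling of `g_E` by a function of the volume alone. Since `dV(h) =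
g_E(g,h)/2` (`hasDerivAt_vol`), half the tautological field is the `g_E`-gradient of `V`. The usual
conformal change therefore makes sense although the metrics are weak: the Christoffel map changes by
`-p/(4V) ((g,h)k + (g,k)h - (h,k)g)`, with pairings in `g_E`.

The curvature correction closes up because `∇^E_h g = (n/4) h` (from `ebinChristoffel_self_right`),
so the `g_E`-Hessian of `V` is a multiple of `g_E`, and because `g_E(g,g) = nV`. Writing `g_p =
e^{2φ} g_E` with `φ = -(p/2) log V`, the form `Hess φ - dφ ⊗ dφ + |dφ|² g_E / 2` equals `(2p-p²)/16
· ((g,·)⊗(g,·)/V² - n/(2V) g_E)`, and its Kulkarni–Nomizu product with the metric is the correction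
(`curvOp_ebinP`). The derivative of the Ebin Christoffel map never has to be computed: it occurs in
both curvatures and cancels.

A weak metric need not have a Levi-Civita connection, so existence is proved with an explicit
Christoffel map (`isLeviCivita_christoffel`). This needs its smoothness along smooth curves, hence
differentiation under the integral, and the first variation of `g_E`, a pointwise matrix identity
(`trPair_ebinChristoffel`). Uniqueness (`IsLeviCivita.unique`) then identifies every Levi-Civita
connection with the explicit one on the space of metrics. -/

noncomputable section

namespace SpaceOfMetrics

/-! ### Smoothness in hom bundles, read in a fixed trivialization -/

section HomBundle

open Bundle ContinuousLinearMap

variable {B F₁ F₂ N : Type*} {m : WithTop ℕ∞} {E₁ E₂ : B → Type*}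
  [∀ x, AddCommGroup (E₁ x)] [∀ x, Module ℝ (E₁ x)] [NormedAddCommGroup F₁] [NormedSpace ℝ F₁]
  [TopologicalSpace (TotalSpace F₁ E₁)] [∀ x, TopologicalSpace (E₁ x)] [∀ x, AddCommGroup (E₂ x)]
  [∀ x, Module ℝ (E₂ x)] [NormedAddCommGroup F₂] [NormedSpace ℝ F₂]
  [TopologicalSpace (TotalSpace F₂ E₂)] [∀ x, TopologicalSpace (E₂ x)]
  {EB : Type*} [NormedAddCommGroup EB] [NormedSpace ℝ EB] {HB : Type*} [TopologicalSpace HB]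
  {IB : ModelWithCorners ℝ EB HB} [TopologicalSpace B] [ChartedSpace HB B] {EN : Type*}
  [NormedAddCommGroup EN] [NormedSpace ℝ EN] {HN : Type*} [TopologicalSpace HN]
  {IN : ModelWithCorners ℝ EN HN} [TopologicalSpace N] [ChartedSpace HN N]
  [FiberBundle F₁ E₁] [VectorBundle ℝ F₁ E₁] [FiberBundle F₂ E₂] [VectorBundle ℝ F₂ E₂]
  [∀ x, IsTopologicalAddGroup (E₂ x)] [∀ x, ContinuousSMul ℝ (E₂ x)]
  [ContMDiffVectorBundle m F₁ E₁ IB] [ContMDiffVectorBundle m F₂ E₂ IB]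

/-- Smoothness of a map to a hom bundle can be tested in the trivializations at any point `i`
whose domains contain the base point. -/
theorem contMDiffAt_hom_bundle_of_mem_baseSet
    (f : N → TotalSpace (F₁ →L[ℝ] F₂) (fun b : B => E₁ b →L[ℝ] E₂ b)) {q : N} (i : B)
    (h₁ : (f q).1 ∈ (trivializationAt F₁ E₁ i).baseSet)
    (h₂ : (f q).1 ∈ (trivializationAt F₂ E₂ i).baseSet) :
    ContMDiffAt IN (IB.prod 𝓘(ℝ, F₁ →L[ℝ] F₂)) m f q ↔
      ContMDiffAt IN IB m (fun x => (f x).1) q ∧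
        ContMDiffAt IN 𝓘(ℝ, F₁ →L[ℝ] F₂) m
          (fun x => inCoordinates F₁ E₁ F₂ E₂ i (f x).1 i (f x).1 (f x).2) q :=
  (trivializationAt (F₁ →L[ℝ] F₂) (fun b : B => E₁ b →L[ℝ] E₂ b) i).contMDiffAt_iff
    (by rw [hom_trivializationAt_source]; exact ⟨h₁, h₂⟩)

end HomBundle

/-! ### Bilinear forms on tangent spaces as matrices in a chart -/

section PointwiseForms

variable {n : ℕ} {M : Type*} [TopologicalSpace M]
  [ChartedSpace (EuclideanSpace ℝ (Fin n)) M] [IsManifold (𝓡 n) ∞ M]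

/-- The matrix of a bilinear form on `T_x M` in the coordinates of the preferred chart at `i`. -/
def formMatrix (i x : M) (B : TangentSpace (𝓡 n) x →L[ℝ] TangentSpace (𝓡 n) x →L[ℝ] ℝ) :
    Matrix (Fin n) (Fin n) ℝ :=
  Matrix.of fun a b => B (coordVec i x a) (coordVec i x b)

theorem formMatrix_apply (i x : M)
    (B : TangentSpace (𝓡 n) x →L[ℝ] TangentSpace (𝓡 n) x →L[ℝ] ℝ) (a b : Fin n) :
    formMatrix i x B a b = B (coordVec i x a) (coordVec i x b) := rfl

theorem mem_baseSet_iff (i x : M) :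
    x ∈ (trivializationAt (EuclideanSpace ℝ (Fin n)) (TangentSpace (𝓡 n) (M := M)) i).baseSet ↔
      x ∈ (chartAt (EuclideanSpace ℝ (Fin n)) i).source := by
  rw [TangentBundle.trivializationAt_baseSet]

/-- The basis of `T_x M` made of the coordinate vector fields of the preferred chart at `i`. -/
def coordBasis (i x : M) (hx : x ∈ (chartAt (EuclideanSpace ℝ (Fin n)) i).source) :
    Module.Basis (Fin n) ℝ (TangentSpace (𝓡 n) x) :=
  (EuclideanSpace.basisFun (Fin n) ℝ).toBasis.map
    ((trivializationAt (EuclideanSpace ℝ (Fin n)) (TangentSpace (𝓡 n) (M := M)) i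
      ).continuousLinearEquivAt ℝ x ((mem_baseSet_iff i x).2 hx)).symm.toLinearEquiv

theorem coordBasis_apply (i x : M) (hx : x ∈ (chartAt (EuclideanSpace ℝ (Fin n)) i).source)
    (a : Fin n) : coordBasis i x hx a = coordVec i x a := by
  simp [coordBasis, coordVec, Bundle.Trivialization.symmL_apply _ ((mem_baseSet_iff i x).2 hx)]

theorem form_eq_sum (i x : M) (hx : x ∈ (chartAt (EuclideanSpace ℝ (Fin n)) i).source)
    (B : TangentSpace (𝓡 n) x →L[ℝ] TangentSpace (𝓡 n) x →L[ℝ] ℝ)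
    (v w : TangentSpace (𝓡 n) x) :
    B v w = ∑ a, ∑ b, (coordBasis i x hx).repr v a * (coordBasis i x hx).repr w b *
      formMatrix i x B a b := by
  conv_lhs => rw [← (coordBasis i x hx).sum_repr v, ← (coordBasis i x hx).sum_repr w]
  simp only [coordBasis_apply, map_sum, map_smul, sum_apply,
    smul_apply, smul_eq_mul, Finset.mul_sum, formMatrix_apply]
  rw [Finset.sum_comm]
  exact Finset.sum_congr rfl fun a _ => Finset.sum_congr rfl fun b _ => by ring

theorem form_ext_matrix (i x : M) (hx : x ∈ (chartAt (EuclideanSpace ℝ (Fin n)) i).source)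
    {B B' : TangentSpace (𝓡 n) x →L[ℝ] TangentSpace (𝓡 n) x →L[ℝ] ℝ}
    (h : formMatrix i x B = formMatrix i x B') : B = B' := by
  ext v w
  rw [form_eq_sum i x hx B, form_eq_sum i x hx B', h]

theorem contMDiffAt_bilin_iff {E H N : Type*} [NormedAddCommGroup E] [NormedSpace ℝ E]
    [TopologicalSpace H] {J : ModelWithCorners ℝ E H} [TopologicalSpace N] [ChartedSpace H N]
    (S : N → EuclideanSpace ℝ (Fin n) →L[ℝ] EuclideanSpace ℝ (Fin n) →L[ℝ] ℝ) (q : N) :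
    ContMDiffAt J 𝓘(ℝ, EuclideanSpace ℝ (Fin n) →L[ℝ] EuclideanSpace ℝ (Fin n) →L[ℝ] ℝ) ∞ S q ↔
      ∀ a b : Fin n, ContMDiffAt J 𝓘(ℝ, ℝ) ∞
        (fun q => S q (EuclideanSpace.single a 1) (EuclideanSpace.single b 1)) q := by
  constructor
  · intro h a b
    exact (h.clm_apply contMDiffAt_const).clm_apply contMDiffAt_const
  · intro h
    have key : S = fun q => ∑ a, ∑ b,
        (S q (EuclideanSpace.single a 1) (EuclideanSpace.single b 1)) •
          ((EuclideanSpace.proj a : EuclideanSpace ℝ (Fin n) →L[ℝ] ℝ).smulRight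
            (EuclideanSpace.proj b : EuclideanSpace ℝ (Fin n) →L[ℝ] ℝ)) := by
      funext q
      ext v w
      have hv := (EuclideanSpace.basisFun (Fin n) ℝ).sum_repr v
      have hw := (EuclideanSpace.basisFun (Fin n) ℝ).sum_repr w
      conv_lhs => rw [← hv, ← hw]
      simp only [map_sum, map_smul, sum_apply, EuclideanSpace.basisFun_apply,
        EuclideanSpace.basisFun_repr, smul_apply, smul_eq_mul, Finset.mul_sum,
        ContinuousLinearMap.smulRight_apply, PiLp.proj_apply]
      rw [Finset.sum_comm]
      exact Finset.sum_congr rfl fun a _ => Finset.sum_congr rfl fun b _ => by ring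
    rw [key]
    exact ContMDiffAt.sum fun a _ => ContMDiffAt.sum fun b _ => (h a b).smul contMDiffAt_const

/-- In the trivialization at `i` the form is represented by its matrix on the coordinate fields. The
base map `f` is general so that the criterion serves both tensor fields on `M` and curves of them,
viewed over `ℝ × M`. -/
theorem contMDiffAt_form_iff {E H N : Type*} [NormedAddCommGroup E] [NormedSpace ℝ E]
    [TopologicalSpace H] {J : ModelWithCorners ℝ E H} [TopologicalSpace N] [ChartedSpace H N]
    {f : N → M}
    (S : ∀ q : N, TangentSpace (𝓡 n) (f q) →L[ℝ] TangentSpace (𝓡 n) (f q) →L[ℝ] ℝ) {q₀ : N}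
    (hf : ContMDiffAt J (𝓡 n) ∞ f q₀) {i : M}
    (hi : f q₀ ∈ (chartAt (EuclideanSpace ℝ (Fin n)) i).source) :
    ContMDiffAt J ((𝓡 n).prod
        𝓘(ℝ, EuclideanSpace ℝ (Fin n) →L[ℝ] EuclideanSpace ℝ (Fin n) →L[ℝ] ℝ)) ∞
      (fun q : N =>
        (Bundle.TotalSpace.mk'
          (EuclideanSpace ℝ (Fin n) →L[ℝ] EuclideanSpace ℝ (Fin n) →L[ℝ] ℝ) (f q) (S q) :
          Bundle.TotalSpace (EuclideanSpace ℝ (Fin n) →L[ℝ] EuclideanSpace ℝ (Fin n) →L[ℝ] ℝ)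
            (fun x : M => TangentSpace (𝓡 n) x →L[ℝ] TangentSpace (𝓡 n) x →L[ℝ] ℝ))) q₀ ↔
      ∀ a b, ContMDiffAt J 𝓘(ℝ, ℝ) ∞ (fun q => formMatrix i (f q) (S q) a b) q₀ := by
  rw [contMDiffAt_hom_bundle_of_mem_baseSet _ i ((mem_baseSet_iff i _).2 hi)
    (by simpa using (mem_baseSet_iff i _).2 hi), and_iff_right hf, contMDiffAt_bilin_iff]
  refine forall_congr' fun a => forall_congr' fun b => ?_
  have hev : ∀ᶠ q in 𝓝 q₀, f q ∈
      (trivializationAt (EuclideanSpace ℝ (Fin n)) (TangentSpace (𝓡 n) (M := M)) i).baseSet :=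
    hf.continuousAt.eventually_mem ((Bundle.Trivialization.open_baseSet _).mem_nhds
      ((mem_baseSet_iff i _).2 hi))
  apply Filter.EventuallyEq.contMDiffAt_iff
  filter_upwards [hev] with q hq
  erw [inCoordinates_apply_eq₂ (E₃ := fun _ : M => ℝ) (F₃ := ℝ) hq hq (by simp)]
  simp only [formMatrix_apply, coordVec, Bundle.Trivialization.symmL_apply _ hq]
  simp

end PointwiseForms

/-! ### Definiteness of the trace form on symmetric matrices -/

section MatrixAlgebra

variable {n : ℕ}

theorem exists_eq_conjTranspose_mul_self {P : Matrix (Fin n) (Fin n) ℝ} (hP : P.PosDef) :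
    ∃ B : Matrix (Fin n) (Fin n) ℝ, P = B.conjTranspose * B := by
  open scoped MatrixOrder in
  exact CStarAlgebra.nonneg_iff_eq_star_mul_self.1 hP.posSemidef.nonneg

/-- For symmetric `H` and positive definite `P`, `tr (P H P H)` is the squared norm of a
symmetric matrix congruent to `H`. -/
theorem trace_sq_nonneg {P H : Matrix (Fin n) (Fin n) ℝ} (hP : P.PosDef) (hH : H.transpose = H) :
    0 ≤ (P * H * (P * H)).trace ∧ ((P * H * (P * H)).trace = 0 → H = 0) := by
  obtain ⟨B, hB⟩ := exists_eq_conjTranspose_mul_self hP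
  have hHc : H.conjTranspose = H := by rw [Matrix.conjTranspose_eq_transpose_of_trivial, hH]
  have key : (P * H * (P * H)).trace =
      ((B * H * B.conjTranspose).conjTranspose * (B * H * B.conjTranspose)).trace := by
    have h1 : P * H * (P * H) = B.conjTranspose * (B * H * B.conjTranspose * B * H) := by
      rw [hB]; simp only [Matrix.mul_assoc]
    rw [h1, Matrix.trace_mul_comm]
    simp only [Matrix.conjTranspose_mul, Matrix.conjTranspose_conjTranspose, hHc, Matrix.mul_assoc]
  refine ⟨?_, fun h0 => ?_⟩
  · rw [key]; exact (Matrix.posSemidef_conjTranspose_mul_self _).trace_nonneg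
  · rw [key, Matrix.trace_conjTranspose_mul_self_eq_zero_iff] at h0
    -- The factor `B` is not known to be invertible at this point, so the vanishing is transferred
    -- to `P H P`, where `P` can be cancelled.
    have h2 : P * H * P = 0 := by
      calc P * H * P = B.conjTranspose * (B * H * B.conjTranspose) * B := by
            rw [hB]; simp only [Matrix.mul_assoc]
        _ = 0 := by rw [h0]; simp
    have hu := (Matrix.isUnit_iff_isUnit_det P).1 hP.isUnit
    calc H = P⁻¹ * (P * H * P) * P⁻¹ := by
          rw [Matrix.mul_assoc P, Matrix.nonsing_inv_mul_cancel_left _ _ hu,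
            Matrix.mul_nonsing_inv_cancel_right _ _ hu]
      _ = 0 := by rw [h2]; simp

end MatrixAlgebra

/-! ### The endomorphism `g⁻¹h`, the trace pairing and volume densities in coordinates -/

section Sharp

/-- `ContinuousLinearMap.inverse` is zero on non-invertible maps. Positivity makes `B` injective,
and equality of dimensions makes it an isomorphism. -/
theorem apply_inverse_of_pos {V : Type*} [NormedAddCommGroup V] [NormedSpace ℝ V]
    [FiniteDimensional ℝ V] (B : V →L[ℝ] V →L[ℝ] ℝ) (hB : ∀ v, v ≠ 0 → 0 < B v v) (φ : V →L[ℝ] ℝ) :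
    B (ContinuousLinearMap.inverse B φ) = φ := by
  have hinj : Function.Injective (B : V →ₗ[ℝ] V →L[ℝ] ℝ) := by
    rw [← LinearMap.ker_eq_bot, LinearMap.ker_eq_bot']
    intro v hv
    by_contra hne
    have h := hB v hne
    have h0 : B v = 0 := hv
    rw [h0] at h
    simp at h
  have hdim : Module.finrank ℝ V = Module.finrank ℝ (V →L[ℝ] ℝ) := by
    rw [← (LinearMap.toContinuousLinearMap (𝕜 := ℝ) (E := V) (F' := ℝ)).finrank_eq]
    exact (Subspace.dual_finrank_eq (K := ℝ) (V := V)).symm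
  set e := ((B : V →ₗ[ℝ] V →L[ℝ] ℝ).linearEquivOfInjective hinj hdim).toContinuousLinearEquiv
  have he : B = (e : V →L[ℝ] V →L[ℝ] ℝ) := by ext; rfl
  rw [he, ContinuousLinearMap.inverse_equiv]
  exact e.apply_symm_apply φ

variable {n : ℕ} {M : Type*} [TopologicalSpace M]
  [ChartedSpace (EuclideanSpace ℝ (Fin n)) M] [IsManifold (𝓡 n) ∞ M]

theorem SymTensor.symm (h : SymTensor n M) (x : M) (v w : TangentSpace (𝓡 n) x) :
    h x v w = h x w v := h.2 x v w

theorem SymTensor.ext {h k : SymTensor n M} (H : ∀ x, h x = k x) : h = k :=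
  Subtype.ext (ContMDiffSection.ext H)

theorem SymTensor.add_apply (h k : SymTensor n M) (x : M) : (h + k) x = h x + k x := rfl

theorem SymTensor.smul_apply (r : ℝ) (h : SymTensor n M) (x : M) : (r • h) x = r • h x := rfl

theorem apply_sharp {g : SymTensor n M} (hg : g ∈ metrics n M) (h : SymTensor n M) (x : M)
    (v : TangentSpace (𝓡 n) x) : g x (sharp g h x v) = h x v :=
  apply_inverse_of_pos (V := EuclideanSpace ℝ (Fin n)) (g x) (hg x) (h x v)

theorem gramMatrix_eq (g : SymTensor n M) (i x : M) : gramMatrix g i x = formMatrix i x (g x) := rfl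

theorem gramMatrix_transpose (g : SymTensor n M) (i x : M) :
    (gramMatrix g i x).transpose = gramMatrix g i x := by
  ext a b
  exact g.symm x _ _

theorem gramMatrix_add (g h : SymTensor n M) (i x : M) :
    gramMatrix (g + h) i x = gramMatrix g i x + gramMatrix h i x := rfl

theorem gramMatrix_smul (r : ℝ) (h : SymTensor n M) (i x : M) :
    gramMatrix (r • h) i x = r • gramMatrix h i x := rfl

variable {g : SymTensor n M} (hg : g ∈ metrics n M) {i x : M}
  (hx : x ∈ (chartAt (EuclideanSpace ℝ (Fin n)) i).source)

include hx in
theorem gramMatrix_dotProduct (h : SymTensor n M) (u : Fin n → ℝ) :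
    u ⬝ᵥ (gramMatrix h i x).mulVec u =
      h x ((coordBasis i x hx).equivFun.symm u) ((coordBasis i x hx).equivFun.symm u) := by
  rw [form_eq_sum i x hx (h x)]
  simp only [dotProduct, Matrix.mulVec, Finset.mul_sum]
  refine Finset.sum_congr rfl fun a _ => Finset.sum_congr rfl fun b _ => ?_
  rw [← gramMatrix_eq, ← (coordBasis i x hx).equivFun_apply, LinearEquiv.apply_symm_apply]
  ring

include hg hx in
theorem gramMatrix_posDef : (gramMatrix g i x).PosDef := by
  refine Matrix.PosDef.of_dotProduct_mulVec_pos ?_ fun u hu => ?_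
  · rw [Matrix.IsHermitian, Matrix.conjTranspose_eq_transpose_of_trivial, gramMatrix_transpose]
  · rw [star_trivial, gramMatrix_dotProduct hx]
    exact hg x _ ((LinearEquiv.map_ne_zero_iff _).2 hu)

include hg hx in
theorem gramMatrix_isUnit_det : IsUnit (gramMatrix g i x).det :=
  (Matrix.isUnit_iff_isUnit_det _).1 (gramMatrix_posDef hg hx).isUnit

include hg in
-- In coordinates `apply_sharp` reads `G S = H`, by symmetry of both forms, and `G` is invertible.
theorem toMatrix_sharp (h : SymTensor n M) :
    LinearMap.toMatrix (coordBasis i x hx) (coordBasis i x hx) (sharp g h x).toLinearMap =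
      (gramMatrix g i x)⁻¹ * gramMatrix h i x := by
  set S := LinearMap.toMatrix (coordBasis i x hx) (coordBasis i x hx) (sharp g h x).toLinearMap
  have key : gramMatrix g i x * S = gramMatrix h i x := by
    ext a b
    have h1 : sharp g h x (coordVec i x b) = ∑ c, S c b • coordVec i x c := by
      conv_lhs => rw [← (coordBasis i x hx).sum_repr (sharp g h x (coordVec i x b))]
      simp only [S, ← coordBasis_apply i x hx, LinearMap.toMatrix_apply]
      rfl
    have h2 := congrArg (fun φ => φ (coordVec i x a)) (apply_sharp hg h x (coordVec i x b))
    simp only [h1, map_sum, map_smul, _root_.sum_apply, _root_.smul_apply, smul_eq_mul] at h2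
    rw [Matrix.mul_apply]
    calc ∑ c, gramMatrix g i x a c * S c b
        = ∑ c, S c b * g x (coordVec i x c) (coordVec i x a) :=
          Finset.sum_congr rfl fun c _ => by rw [mul_comm, g.symm x]; rfl
      _ = h x (coordVec i x b) (coordVec i x a) := h2
      _ = gramMatrix h i x a b := by rw [h.symm x]; rfl
  rw [← key, Matrix.nonsing_inv_mul_cancel_left _ _ (gramMatrix_isUnit_det hg hx)]

include hg hx in
theorem trPair_eq (h k : SymTensor n M) :
    trPair g h k x = ((gramMatrix g i x)⁻¹ * gramMatrix h i x *
      ((gramMatrix g i x)⁻¹ * gramMatrix k i x)).trace := by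
  rw [trPair, LinearMap.trace_eq_matrix_trace ℝ (coordBasis i x hx), ← toMatrix_sharp hg hx,
    ← toMatrix_sharp hg hx, ← LinearMap.toMatrix_comp]
  rfl

/-- The ratio `dV_c / dV_g` of volume densities. -/
def densityRatio (g c : SymTensor n M) (x : M) : ℝ :=
  Real.sqrt (LinearMap.det (sharp g c x).toLinearMap)

include hg hx in
theorem densityRatio_eq (c : SymTensor n M) :
    densityRatio g c x = Real.sqrt (((gramMatrix g i x)⁻¹ * gramMatrix c i x).det) := by
  rw [densityRatio, ← LinearMap.det_toMatrix (coordBasis i x hx), toMatrix_sharp hg hx]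

include hg hx in
-- The Gram determinants depend on the chart but their quotient `det (g⁻¹c)` does not, so a change
-- of metric multiplies the density by a function on `M`.
theorem sqrt_det_gramMatrix (c : SymTensor n M) :
    Real.sqrt (gramMatrix c i x).det =
      densityRatio g c x * Real.sqrt (gramMatrix g i x).det := by
  have hpos := (gramMatrix_posDef hg hx).det_pos
  rw [densityRatio_eq hg hx, ← Real.sqrt_mul' _ hpos.le, Matrix.det_mul, Matrix.det_nonsing_inv,
    Ring.inverse_eq_inv']
  congr 1
  field_simp

/-- The form `(v, w) ↦ h(v, g⁻¹ k w)`. -/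
def formProd (g h k : SymTensor n M) (x : M) :
    TangentSpace (𝓡 n) x →L[ℝ] TangentSpace (𝓡 n) x →L[ℝ] ℝ :=
  (ContinuousLinearMap.precomp ℝ (sharp g k x)).comp (h x)

theorem formProd_apply (g h k : SymTensor n M) (x : M) (v w : TangentSpace (𝓡 n) x) :
    formProd g h k x v w = h x v (sharp g k x w) := rfl

include hg hx in
theorem formMatrix_formProd (h k : SymTensor n M) :
    formMatrix i x (formProd g h k x) =
      gramMatrix h i x * ((gramMatrix g i x)⁻¹ * gramMatrix k i x) := by
  rw [← toMatrix_sharp hg hx]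
  ext a b
  set S := LinearMap.toMatrix (coordBasis i x hx) (coordBasis i x hx) (sharp g k x).toLinearMap
  have h1 : sharp g k x (coordVec i x b) = ∑ c, S c b • coordVec i x c := by
    conv_lhs => rw [← (coordBasis i x hx).sum_repr (sharp g k x (coordVec i x b))]
    simp only [S, ← coordBasis_apply i x hx, LinearMap.toMatrix_apply]
    rfl
  rw [formMatrix_apply, formProd_apply, h1, Matrix.mul_apply]
  simp only [map_sum, map_smul, smul_eq_mul]
  exact Finset.sum_congr rfl fun c _ => by rw [mul_comm]; rfl

include hg in
-- Pointwise source of the definiteness of the Ebin metric.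
theorem trPair_self (h : SymTensor n M) (x : M) :
    0 ≤ trPair g h h x ∧ (trPair g h h x = 0 → h x = 0) := by
  have hx := mem_chart_source (EuclideanSpace ℝ (Fin n)) x
  rw [trPair_eq hg hx]
  obtain ⟨h1, h2⟩ := trace_sq_nonneg (gramMatrix_posDef hg hx).inv (gramMatrix_transpose h x x)
  exact ⟨h1, fun h0 => form_ext_matrix x x hx (h2 h0)⟩

end Sharp

/-! ### Smooth matrix-valued functions -/

section SmoothMatrix

variable {E H N : Type*} [NormedAddCommGroup E] [NormedSpace ℝ E]
  [TopologicalSpace H] {J : ModelWithCorners ℝ E H} [TopologicalSpace N] [ChartedSpace H N] {n : ℕ}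

variable (J) in
/-- A matrix-valued function all of whose entries are smooth at `q`. -/
def SmoothMatrixAt (A : N → Matrix (Fin n) (Fin n) ℝ) (q : N) : Prop :=
  ∀ a b, ContMDiffAt J 𝓘(ℝ, ℝ) ∞ (fun y => A y a b) q

theorem contMDiffAt_prod_univ {ι : Type*} {f : ι → N → ℝ} {q : N} (s : Finset ι)
    (h : ∀ i, ContMDiffAt J 𝓘(ℝ, ℝ) ∞ (f i) q) :
    ContMDiffAt J 𝓘(ℝ, ℝ) ∞ (fun y => ∏ i ∈ s, f i y) q :=
  contMDiffAt_finsetProd fun i _ => h i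

variable {A B : N → Matrix (Fin n) (Fin n) ℝ} {q : N}

theorem SmoothMatrixAt.add (hA : SmoothMatrixAt J A q) (hB : SmoothMatrixAt J B q) :
    SmoothMatrixAt J (fun y => A y + B y) q := fun a b => (hA a b).add (hB a b)

theorem SmoothMatrixAt.smul {f : N → ℝ} (hf : ContMDiffAt J 𝓘(ℝ, ℝ) ∞ f q)
    (hA : SmoothMatrixAt J A q) : SmoothMatrixAt J (fun y => f y • A y) q :=
  fun a b => hf.mul (hA a b)

theorem SmoothMatrixAt.mul (hA : SmoothMatrixAt J A q) (hB : SmoothMatrixAt J B q) :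
    SmoothMatrixAt J (fun y => A y * B y) q := fun a b => by
  simp only [Matrix.mul_apply]
  exact ContMDiffAt.sum fun c _ => (hA a c).mul (hB c b)

theorem SmoothMatrixAt.trace (hA : SmoothMatrixAt J A q) :
    ContMDiffAt J 𝓘(ℝ, ℝ) ∞ (fun y => (A y).trace) q := by
  simp only [Matrix.trace, Matrix.diag]
  exact ContMDiffAt.sum fun c _ => hA c c

theorem SmoothMatrixAt.det (hA : SmoothMatrixAt J A q) :
    ContMDiffAt J 𝓘(ℝ, ℝ) ∞ (fun y => (A y).det) q := by
  simp only [Matrix.det_apply']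
  exact ContMDiffAt.sum fun σ _ =>
    contMDiffAt_const.mul (contMDiffAt_prod_univ _ fun i => hA (σ i) i)

/-- Cramer's rule: each entry is a cofactor, itself a determinant with one row made constant,
divided by the determinant. -/
theorem SmoothMatrixAt.inv (hA : SmoothMatrixAt J A q) (hdet : (A q).det ≠ 0) :
    SmoothMatrixAt J (fun y => (A y)⁻¹) q := fun a b => by
  simp only [Matrix.inv_def, Ring.inverse_eq_inv', Matrix.smul_apply, smul_eq_mul,
    Matrix.adjugate_apply]
  refine (hA.det.inv₀ hdet).mul (SmoothMatrixAt.det fun c d => ?_)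
  by_cases h : c = b
  · subst h; simp only [Matrix.updateRow_self]; exact contMDiffAt_const
  · simp only [Matrix.updateRow_ne h]; exact hA c d

theorem contMDiffAt_real_sqrt {f : N → ℝ} (hf : ContMDiffAt J 𝓘(ℝ, ℝ) ∞ f q) (h : f q ≠ 0) :
    ContMDiffAt J 𝓘(ℝ, ℝ) ∞ (fun y => Real.sqrt (f y)) q :=
  (Real.contDiffAt_sqrt h).contMDiffAt.comp q hf

end SmoothMatrix

/-! ### Time derivatives of jointly smooth functions -/

section TimeDerivative

variable {E H N : Type*} [NormedAddCommGroup E] [NormedSpace ℝ E]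
  [TopologicalSpace H] {J : ModelWithCorners ℝ E H} [TopologicalSpace N] [ChartedSpace H N]

theorem hasDerivAt_fst_of_contMDiffAt {F : ℝ × N → ℝ} {t : ℝ} {x : N}
    (hF : ContMDiffAt (𝓘(ℝ, ℝ).prod J) 𝓘(ℝ, ℝ) ∞ F (t, x)) :
    HasDerivAt (fun s => F (s, x)) (deriv (fun s => F (s, x)) t) t := by
  have h : ContMDiffAt 𝓘(ℝ, ℝ) 𝓘(ℝ, ℝ) ∞ (fun s => F (s, x)) t :=
    ContMDiffAt.comp t hF (contMDiffAt_id.prodMk contMDiffAt_const)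
  exact (h.contDiffAt.differentiableAt (by simp)).hasDerivAt

/-- The time variable is separated from the parameter `q`, and the manifold derivative in `s` is
applied to `1`. That joint smoothness survives is what lets the later arguments be iterated. -/
theorem contMDiffAt_deriv_fst [IsManifold J 1 N] {F : ℝ × N → ℝ} {q : ℝ × N}
    (hF : ContMDiffAt (𝓘(ℝ, ℝ).prod J) 𝓘(ℝ, ℝ) ∞ F q) :
    ContMDiffAt (𝓘(ℝ, ℝ).prod J) 𝓘(ℝ, ℝ) ∞
      (fun q : ℝ × N => deriv (fun s => F (s, q.2)) q.1) q := by
  have h1 : ContMDiffAt ((𝓘(ℝ, ℝ).prod J).prod 𝓘(ℝ, ℝ)) 𝓘(ℝ, ℝ) ∞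
      (Function.uncurry fun (q : ℝ × N) (s : ℝ) => F (s, q.2)) (q, q.1) :=
    ContMDiffAt.comp (q, q.1) (f := fun z : (ℝ × N) × ℝ => (z.2, z.1.2)) (by exact hF)
      (contMDiffAt_snd.prodMk (contMDiffAt_snd.comp (q, q.1) contMDiffAt_fst))
  have h2 := ContMDiffAt.mfderiv (fun (q : ℝ × N) (s : ℝ) => F (s, q.2)) (fun q => q.1) h1
    (contMDiffAt_fst (n := ∞)) (by simp)
  have h3 := h2.clm_apply (contMDiffAt_const (c := (1 : ℝ)))
  convert! h3 using 2 with y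
  simp [inTangentCoordinates_model_space, mfderiv_eq_fderiv]

end TimeDerivative

/-! ### Smooth curves of tensor fields -/

section SmoothCurves

variable {n : ℕ} {M : Type*} [TopologicalSpace M]
  [ChartedSpace (EuclideanSpace ℝ (Fin n)) M] [IsManifold (𝓡 n) ∞ M]

theorem smoothMatrixAt_gramMatrix (h : SymTensor n M) {i x : M}
    (hx : x ∈ (chartAt (EuclideanSpace ℝ (Fin n)) i).source) :
    SmoothMatrixAt (𝓡 n) (fun y => gramMatrix h i y) x :=
  (contMDiffAt_form_iff (f := fun y : M => y) (fun y => h y) contMDiffAt_id hx).1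
    (h.1.contMDiff x)

/-- A smooth symmetric family of bilinear forms on the tangent spaces, as a tensor field. -/
def SymTensor.mk' (S : ∀ x : M, TangentSpace (𝓡 n) x →L[ℝ] TangentSpace (𝓡 n) x →L[ℝ] ℝ)
    (hs : ∀ x v w, S x v w = S x w v)
    (hS : ∀ x : M, SmoothMatrixAt (𝓡 n) (fun y => formMatrix x y (S y)) x) : SymTensor n M :=
  ⟨⟨S, fun x => (contMDiffAt_form_iff (f := fun y : M => y) S contMDiffAt_id
    (mem_chart_source _ x)).2 (hS x)⟩, hs⟩

theorem isSmoothCurve_iff {c : ℝ → SymTensor n M} :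
    IsSmoothCurve c ↔ ∀ q : ℝ × M, SmoothMatrixAt (𝓘(ℝ, ℝ).prod (𝓡 n))
      (fun y : ℝ × M => gramMatrix (c y.1) q.2 y.2) q :=
  forall_congr' fun q => contMDiffAt_form_iff (f := fun y : ℝ × M => y.2) (fun y => c y.1 y.2)
    contMDiffAt_snd (mem_chart_source _ q.2)

theorem isSmoothCurve_const (h : SymTensor n M) : IsSmoothCurve fun _ => h :=
  isSmoothCurve_iff.2 fun q a b => ContMDiffAt.comp (g := fun y => gramMatrix h q.2 y a b) q
    (smoothMatrixAt_gramMatrix h (mem_chart_source _ q.2) a b) contMDiffAt_snd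

theorem IsSmoothCurve.add {a b : ℝ → SymTensor n M} (ha : IsSmoothCurve a)
    (hb : IsSmoothCurve b) : IsSmoothCurve fun t => a t + b t :=
  isSmoothCurve_iff.2 fun q => (isSmoothCurve_iff.1 ha q).add (isSmoothCurve_iff.1 hb q)

theorem IsSmoothCurve.smul {f : ℝ → ℝ} {a : ℝ → SymTensor n M} (hf : ContDiff ℝ ∞ f)
    (ha : IsSmoothCurve a) : IsSmoothCurve fun t => f t • a t :=
  isSmoothCurve_iff.2 fun q => SmoothMatrixAt.smul (f := fun y : ℝ × M => f y.1)
    (hf.contDiffAt.contMDiffAt.comp q contMDiffAt_fst) (isSmoothCurve_iff.1 ha q)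

variable {c a b : ℝ → SymTensor n M}

theorem contMDiff_trPair (hc : IsSmoothCurve c) (hm : ∀ t, c t ∈ metrics n M)
    (ha : IsSmoothCurve a) (hb : IsSmoothCurve b) :
    ContMDiff (𝓘(ℝ, ℝ).prod (𝓡 n)) 𝓘(ℝ, ℝ) ∞
      (fun q : ℝ × M => trPair (c q.1) (a q.1) (b q.1) q.2) := by
  intro q
  have hinv := (isSmoothCurve_iff.1 hc q).inv
    (gramMatrix_isUnit_det (hm q.1) (mem_chart_source _ q.2)).ne_zero
  have h := ((hinv.mul (isSmoothCurve_iff.1 ha q)).mul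
    (hinv.mul (isSmoothCurve_iff.1 hb q))).trace
  refine h.congr_of_eventuallyEq ?_
  filter_upwards [continuous_snd.continuousAt.eventually_mem
    ((chartAt (EuclideanSpace ℝ (Fin n)) q.2).open_source.mem_nhds (mem_chart_source _ q.2))]
    with y hy
  exact trPair_eq (hm y.1) hy _ _

theorem contMDiff_densityRatio (hc : IsSmoothCurve c) (hm : ∀ t, c t ∈ metrics n M)
    {g : SymTensor n M} (hg : g ∈ metrics n M) :
    ContMDiff (𝓘(ℝ, ℝ).prod (𝓡 n)) 𝓘(ℝ, ℝ) ∞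
      (fun q : ℝ × M => densityRatio g (c q.1) q.2) := by
  intro q
  have hq := mem_chart_source (EuclideanSpace ℝ (Fin n)) q.2
  have hinv := (isSmoothCurve_iff.1 (isSmoothCurve_const g) q).inv
    (gramMatrix_isUnit_det hg hq).ne_zero
  have h := contMDiffAt_real_sqrt (hinv.mul (isSmoothCurve_iff.1 hc q)).det (by
    rw [Matrix.det_mul]
    exact mul_ne_zero (gramMatrix_posDef hg hq).inv.det_pos.ne'
      (gramMatrix_posDef (hm q.1) hq).det_pos.ne')
  refine h.congr_of_eventuallyEq ?_
  filter_upwards [continuous_snd.continuousAt.eventually_mem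
    ((chartAt (EuclideanSpace ℝ (Fin n)) q.2).open_source.mem_nhds (mem_chart_source _ q.2))]
    with y hy
  exact densityRatio_eq hg hy _

/-- The derivative of a smooth curve of tensor fields is again a smooth tensor field. -/
theorem IsSmoothCurve.exists_hasDerivAt (hc : IsSmoothCurve c) (t : ℝ) :
    ∃ s : SymTensor n M, ∀ (x : M) (v w : TangentSpace (𝓡 n) x),
      HasDerivAt (fun u => c u x v w) (s x v w) t := by
  have hd : ∀ (x : M) (v w : TangentSpace (𝓡 n) x),
      DifferentiableAt ℝ (fun u => c u x v w) t := by
    intro x v w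
    have hx := mem_chart_source (EuclideanSpace ℝ (Fin n)) x
    have h : (fun u => c u x v w) = fun u => ∑ a, ∑ b, (coordBasis x x hx).repr v a *
        (coordBasis x x hx).repr w b * gramMatrix (c u) x x a b :=
      funext fun u => form_eq_sum x x hx (c u x) v w
    rw [h]
    refine DifferentiableAt.fun_sum fun a _ => DifferentiableAt.fun_sum fun b _ => ?_
    exact (hasDerivAt_fst_of_contMDiffAt (isSmoothCurve_iff.1 hc (t, x) a b)
      ).differentiableAt.const_mul _
  -- The derivative exists for each pair of vectors and is bilinear in them; continuity is automatic
  -- in finite dimension.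
  let L : ∀ x : M, TangentSpace (𝓡 n) x →ₗ[ℝ] TangentSpace (𝓡 n) x →ₗ[ℝ] ℝ := fun x =>
    LinearMap.mk₂ ℝ (fun v w => deriv (fun u => c u x v w) t)
      (fun v v' w => by simp only [map_add, _root_.add_apply]; exact deriv_fun_add (hd x v w) (hd x v' w))
      (fun r v w => by
        simp only [map_smul, _root_.smul_apply, smul_eq_mul]; exact deriv_const_mul _ (hd x v w))
      (fun v w w' => by simp only [map_add]; exact deriv_fun_add (hd x v w) (hd x v w'))
      (fun r v w => by simp only [map_smul, smul_eq_mul]; exact deriv_const_mul _ (hd x v w))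
  let S : ∀ x : M, TangentSpace (𝓡 n) x →L[ℝ] TangentSpace (𝓡 n) x →L[ℝ] ℝ := fun x =>
    LinearMap.toContinuousLinearMap (𝕜 := ℝ) (E := EuclideanSpace ℝ (Fin n))
      (F' := EuclideanSpace ℝ (Fin n) →L[ℝ] ℝ)
      ((LinearMap.toContinuousLinearMap (𝕜 := ℝ) (E := EuclideanSpace ℝ (Fin n)) (F' := ℝ)
        ).toLinearMap ∘ₗ L x)
  have hS : ∀ x v w, S x v w = deriv (fun u => c u x v w) t := fun x v w => rfl
  refine ⟨SymTensor.mk' S (fun x v w => ?_) fun x a b => ?_, fun x v w => ?_⟩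
  · rw [hS, hS]; simp only [(c _).symm x v w]
  -- Smoothness in the point of `M` is joint smoothness restricted to the slice `{t} × M`.
  · have h := contMDiffAt_deriv_fst (isSmoothCurve_iff.1 hc (t, x) a b)
    exact ContMDiffAt.comp (f := fun y : M => (t, y)) x h (contMDiffAt_const.prodMk contMDiffAt_id)
  · exact (hd x v w).hasDerivAt

end SmoothCurves

/-! ### The volume integral as a positive functional and as a measure -/

section VolumeIntegral

open MeasureTheory

variable {n : ℕ} {M : Type*} [TopologicalSpace M]
  [ChartedSpace (EuclideanSpace ℝ (Fin n)) M] [IsManifold (𝓡 n) ∞ M]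
  [CompactSpace M] [T2Space M]

/-- The integrand of `volIntegral` in the preferred chart at `i`. -/
def chartIntegrand (g : SymTensor n M) (f : M → ℝ) (i : M) (y : EuclideanSpace ℝ (Fin n)) : ℝ :=
  chartPartition n M i ((extChartAt (𝓡 n) i).symm y) * f ((extChartAt (𝓡 n) i).symm y) *
    Real.sqrt (gramMatrix g i ((extChartAt (𝓡 n) i).symm y)).det

theorem volIntegral_eq_finsum (g : SymTensor n M) (f : M → ℝ) :
    volIntegral g f = ∑ᶠ i : M, ∫ y in (extChartAt (𝓡 n) i).target, chartIntegrand g f i y := rfl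

omit [IsManifold (𝓡 n) ∞ M] [CompactSpace M] [T2Space M] in
theorem extChartAt_symm_mem (i : M) {y : EuclideanSpace ℝ (Fin n)}
    (hy : y ∈ (extChartAt (𝓡 n) i).target) :
    (extChartAt (𝓡 n) i).symm y ∈ (chartAt (EuclideanSpace ℝ (Fin n)) i).source := by
  rw [← extChartAt_source (𝓡 n)]
  exact (extChartAt (𝓡 n) i).map_target hy

theorem continuousOn_chartIntegrand (g : SymTensor n M) {f : M → ℝ} (hf : Continuous f) (i : M) :
    ContinuousOn (chartIntegrand g f i) (extChartAt (𝓡 n) i).target := by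
  have hs := continuousOn_extChartAt_symm (I := 𝓡 n) i
  have hG : ContinuousOn (fun x : M => (gramMatrix g i x).det)
      (chartAt (EuclideanSpace ℝ (Fin n)) i).source := fun x hx =>
    (smoothMatrixAt_gramMatrix g hx).det.continuousAt.continuousWithinAt
  exact (((chartPartition n M i).contMDiff.continuous.comp_continuousOn hs).mul
    (hf.comp_continuousOn hs)).mul (Real.continuous_sqrt.comp_continuousOn
      (hG.comp hs fun y hy => extChartAt_symm_mem i hy))

/-- The density may be unbounded on the chart target, but the integrand vanishes off the image of
the compact support of `ρᵢ`, where it is continuous. -/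
theorem integrableOn_chartIntegrand (g : SymTensor n M) {f : M → ℝ} (hf : Continuous f) (i : M) :
    IntegrableOn (chartIntegrand g f i) (extChartAt (𝓡 n) i).target := by
  have hsub : tsupport (chartPartition n M i) ⊆ (extChartAt (𝓡 n) i).source := by
    rw [extChartAt_source]
    exact (SmoothPartitionOfUnity.exists_isSubordinate_chartAt_source (𝓡 n) M).choose_spec i
  have hK : IsCompact (extChartAt (𝓡 n) i '' tsupport (chartPartition n M i)) :=
    (isClosed_tsupport _).isCompact.image_of_continuousOn
      ((continuousOn_extChartAt (I := 𝓡 n) i).mono hsub)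
  have hKt : extChartAt (𝓡 n) i '' tsupport (chartPartition n M i) ⊆
      (extChartAt (𝓡 n) i).target := by
    rintro _ ⟨x, hx, rfl⟩
    exact (extChartAt (𝓡 n) i).map_source (hsub hx)
  refine (((continuousOn_chartIntegrand g hf i).mono hKt).integrableOn_compact hK
    ).of_forall_sdiff_eq_zero (isOpen_extChartAt_target i).measurableSet fun y hy => ?_
  have h0 : chartPartition n M i ((extChartAt (𝓡 n) i).symm y) = 0 := by
    by_contra hne
    exact hy.2 ⟨_, subset_tsupport _ hne, (extChartAt (𝓡 n) i).right_inv hy.1⟩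
  rw [chartIntegrand, h0, zero_mul, zero_mul]

variable (n M) in
/-- The charts that contribute to `volIntegral`. -/
def chartFinset : Finset M :=
  ((chartPartition n M).locallyFinite.finite_nonempty_of_compact).toFinset

theorem mem_chartFinset {i x : M} (h : chartPartition n M i x ≠ 0) : i ∈ chartFinset n M :=
  (Set.Finite.mem_toFinset _).2 ⟨x, h⟩

theorem volIntegral_eq_sum (g : SymTensor n M) (f : M → ℝ) :
    volIntegral g f =
      ∑ i ∈ chartFinset n M, ∫ y in (extChartAt (𝓡 n) i).target, chartIntegrand g f i y := by
  rw [volIntegral_eq_finsum]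
  refine finsum_eq_sum_of_support_subset _ fun i hi => ?_
  by_contra hni
  refine hi ?_
  have h0 : chartIntegrand g f i = fun _ => 0 := by
    funext y
    have : chartPartition n M i ((extChartAt (𝓡 n) i).symm y) = 0 := by
      by_contra hne
      exact hni (mem_chartFinset hne)
    rw [chartIntegrand, this, zero_mul, zero_mul]
  simp [h0]

theorem volIntegral_add (g : SymTensor n M) {f₁ f₂ : M → ℝ} (h₁ : Continuous f₁)
    (h₂ : Continuous f₂) :
    volIntegral g (fun x => f₁ x + f₂ x) = volIntegral g f₁ + volIntegral g f₂ := by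
  simp only [volIntegral_eq_sum, ← Finset.sum_add_distrib]
  refine Finset.sum_congr rfl fun i _ => ?_
  rw [← integral_add (integrableOn_chartIntegrand g h₁ i) (integrableOn_chartIntegrand g h₂ i)]
  congr 1 with y
  simp only [chartIntegrand]
  ring

theorem volIntegral_const_mul (g : SymTensor n M) (r : ℝ) (f : M → ℝ) :
    volIntegral g (fun x => r * f x) = r * volIntegral g f := by
  simp only [volIntegral_eq_sum, Finset.mul_sum]
  refine Finset.sum_congr rfl fun i _ => ?_
  rw [← integral_const_mul]
  congr 1 with y
  simp only [chartIntegrand]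
  ring

theorem chartIntegrand_nonneg (g : SymTensor n M) {f : M → ℝ} (hf : ∀ x, 0 ≤ f x) (i : M)
    (y : EuclideanSpace ℝ (Fin n)) : 0 ≤ chartIntegrand g f i y :=
  mul_nonneg (mul_nonneg ((chartPartition n M).nonneg i _) (hf _)) (Real.sqrt_nonneg _)

theorem volIntegral_nonneg (g : SymTensor n M) {f : M → ℝ} (hf : ∀ x, 0 ≤ f x) :
    0 ≤ volIntegral g f := by
  rw [volIntegral_eq_sum]
  exact Finset.sum_nonneg fun i _ => integral_nonneg (chartIntegrand_nonneg g hf i)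

/-- Some `ρᵢ` is positive at `x`; in that chart the integrand is positive on a nonempty open set,
which has positive Lebesgue measure. -/
theorem volIntegral_pos {g : SymTensor n M} (hg : g ∈ metrics n M) {f : M → ℝ} (hf : Continuous f)
    (h0 : ∀ x, 0 ≤ f x) {x : M} (hx : 0 < f x) : 0 < volIntegral g f := by
  obtain ⟨i, hi⟩ := (chartPartition n M).exists_pos_of_mem (Set.mem_univ x)
  rw [volIntegral_eq_sum]
  refine Finset.sum_pos' (fun i _ => integral_nonneg (chartIntegrand_nonneg g h0 i))
    ⟨i, mem_chartFinset hi.ne', ?_⟩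
  have hxs : x ∈ (chartAt (EuclideanSpace ℝ (Fin n)) i).source :=
    (SmoothPartitionOfUnity.exists_isSubordinate_chartAt_source (𝓡 n) M).choose_spec i
      (subset_tsupport _ hi.ne')
  have hxe : x ∈ (extChartAt (𝓡 n) i).source := by rwa [extChartAt_source]
  set y₀ := extChartAt (𝓡 n) i x with hy₀
  have hy : y₀ ∈ (extChartAt (𝓡 n) i).target := (extChartAt (𝓡 n) i).map_source hxe
  have hpos : 0 < chartIntegrand g f i y₀ := by
    rw [chartIntegrand, (extChartAt (𝓡 n) i).left_inv hxe]
    exact mul_pos (mul_pos hi hx) (Real.sqrt_pos.2 (gramMatrix_posDef hg hxs).det_pos)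
  have hopen := isOpen_extChartAt_target (I := 𝓡 n) i
  rw [setIntegral_pos_iff_support_of_nonneg_ae
    (Filter.Eventually.of_forall (chartIntegrand_nonneg g h0 i))
    (integrableOn_chartIntegrand g hf i)]
  have hcont := (continuousOn_chartIntegrand g hf i).isOpen_inter_preimage hopen
    (isOpen_Ioi (a := (0 : ℝ)))
  refine lt_of_lt_of_le (hcont.measure_pos volume ⟨y₀, hy, hpos⟩) (measure_mono ?_)
  exact fun y hy' => ⟨ne_of_gt hy'.2, hy'.1⟩

/-- Change of the Riemannian volume density. -/
theorem volIntegral_eq_densityRatio {g : SymTensor n M} (hg : g ∈ metrics n M)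
    (c : SymTensor n M) (f : M → ℝ) :
    volIntegral c f = volIntegral g fun x => f x * densityRatio g c x := by
  simp only [volIntegral_eq_sum]
  refine Finset.sum_congr rfl fun i _ => setIntegral_congr_fun
    (isOpen_extChartAt_target i).measurableSet fun y hy => ?_
  simp only [chartIntegrand]
  rw [sqrt_det_gramMatrix hg (extChartAt_symm_mem i hy) c]
  ring

open CompactlySupported in
/-- The functional `f ↦ ∫_M f dV_g` on continuous functions is given by a finite measure. -/
theorem exists_measure_volIntegral [MeasurableSpace M] [BorelSpace M] (g : SymTensor n M) :
    ∃ μ : Measure M, IsFiniteMeasure μ ∧ ∀ f : M → ℝ, Continuous f →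
      volIntegral g f = ∫ x, f x ∂μ := by
  -- Riesz–Markov replaces the sum over charts by one finite measure on `M`, so that the standard
  -- theorems on parametric integrals apply directly.
  let Λ : C_c(M, ℝ) →ₚ[ℝ] ℝ := PositiveLinearMap.mk₀
    { toFun := fun f => volIntegral g f
      map_add' := fun f₁ f₂ => volIntegral_add g f₁.continuous f₂.continuous
      map_smul' := fun r f => volIntegral_const_mul g r f }
    fun f hf => volIntegral_nonneg g hf
  refine ⟨RealRMK.rieszMeasure Λ, inferInstance, fun f hf => ?_⟩
  exact (RealRMK.integral_rieszMeasure Λ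
    (CompactlySupportedContinuousMap.continuousMapEquiv ⟨f, hf⟩)).symm

end VolumeIntegral

/-! ### Differentiation under the integral over a compact manifold -/

section ParametricIntegral

open MeasureTheory

variable {E H N : Type*} [NormedAddCommGroup E] [NormedSpace ℝ E]
  [TopologicalSpace H] {J : ModelWithCorners ℝ E H} [TopologicalSpace N] [ChartedSpace H N]
  [IsManifold J 1 N] [CompactSpace N] [MeasurableSpace N] [BorelSpace N]
  (μ : Measure N) [IsFiniteMeasure μ]

theorem hasDerivAt_integral_of_contMDiff {F : ℝ × N → ℝ}
    (hF : ContMDiff (𝓘(ℝ, ℝ).prod J) 𝓘(ℝ, ℝ) ∞ F) (t : ℝ) :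
    HasDerivAt (fun s => ∫ x, F (s, x) ∂μ) (∫ x, deriv (fun s => F (s, x)) t ∂μ) t := by
  have hF' : Continuous fun q : ℝ × N => deriv (fun s => F (s, q.2)) q.1 :=
    continuous_iff_continuousAt.2 fun q => (contMDiffAt_deriv_fst (hF q)).continuousAt
  -- The dominating function is a constant: a bound for the time derivative on a compact set.
  have hcompact : IsCompact (Metric.closedBall t 1 ×ˢ (Set.univ : Set N)) :=
    (isCompact_closedBall t 1).prod isCompact_univ
  obtain ⟨C, hC⟩ := hcompact.exists_bound_of_continuousOn hF'.continuousOn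
  have hint : ∀ {f : N → ℝ}, Continuous f → Integrable f μ := fun hf =>
    hf.integrable_of_hasCompactSupport (HasCompactSupport.of_compactSpace _)
  refine (hasDerivAt_integral_of_dominated_loc_of_deriv_le (bound := fun _ => C)
    (F' := fun s x => deriv (fun s => F (s, x)) s)
    (Metric.closedBall_mem_nhds t one_pos) ?_ ?_ ?_ ?_ (integrable_const C) ?_).2
  · exact Filter.Eventually.of_forall fun s =>
      (hF.continuous.comp (by fun_prop : Continuous fun x : N => (s, x))).aestronglyMeasurable
  · exact hint (hF.continuous.comp (by fun_prop : Continuous fun x : N => (t, x)))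
  · exact (hF'.comp (by fun_prop : Continuous fun x : N => (t, x))).aestronglyMeasurable
  · exact Filter.Eventually.of_forall fun x s hs => hC (s, x) ⟨hs, Set.mem_univ x⟩
  · exact Filter.Eventually.of_forall fun x s _ => hasDerivAt_fst_of_contMDiffAt (hF (s, x))

theorem contDiff_integral_of_contMDiff {F : ℝ × N → ℝ}
    (hF : ContMDiff (𝓘(ℝ, ℝ).prod J) 𝓘(ℝ, ℝ) ∞ F) :
    ContDiff ℝ ∞ fun s => ∫ x, F (s, x) ∂μ := by
  rw [contDiff_infty]
  intro k
  induction k generalizing F with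
  | zero =>
    exact contDiff_zero.2 (Differentiable.continuous (𝕜 := ℝ) fun t =>
      (hasDerivAt_integral_of_contMDiff μ hF t).differentiableAt)
  | succ k ih =>
    push_cast
    rw [contDiff_succ_iff_deriv]
    refine ⟨fun t => (hasDerivAt_integral_of_contMDiff μ hF t).differentiableAt, by simp, ?_⟩
    have h := ih (F := fun q : ℝ × N => deriv (fun s => F (s, q.2)) q.1)
      fun q => contMDiffAt_deriv_fst (hF q)
    convert! h using 1
    exact funext fun t => (hasDerivAt_integral_of_contMDiff μ hF t).deriv

end ParametricIntegral

/-! ### First variation of determinant, inverse and trace -/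

section MatrixCalculus

open scoped Matrix.Norms.Operator

variable {n : ℕ}

theorem hasDerivAt_det_one_add_smul (A : Matrix (Fin n) (Fin n) ℝ) :
    HasDerivAt (fun t : ℝ => (1 + t • A).det) A.trace 0 := by
  set P := (Matrix.det (1 + (Polynomial.X : Polynomial ℝ) • A.map Polynomial.C)).divX.divX with hP
  have hdet : (fun t : ℝ => (1 + t • A).det) = fun t => 1 + A.trace * t + P.eval t * t ^ 2 :=
    funext fun t => Matrix.det_one_add_smul t A
  rw [hdet]
  have h := (((hasDerivAt_id (0 : ℝ)).const_mul A.trace).const_add 1).add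
    ((P.hasDerivAt 0).mul ((hasDerivAt_id (0 : ℝ)).pow 2))
  refine h.congr_deriv ?_
  simp

theorem hasDerivAt_inv_one_add_smul (A : Matrix (Fin n) (Fin n) ℝ) :
    HasDerivAt (fun t : ℝ => (1 + t • A)⁻¹) (-A) 0 := by
  have h1 : HasDerivAt (fun t : ℝ => 1 + t • A) A 0 := by
    have h := ((hasDerivAt_id (0 : ℝ)).smul_const A).const_add 1
    rw [one_smul] at h
    exact h
  have h2 := hasFDerivAt_ringInverse (𝕜 := ℝ) (1 : (Matrix (Fin n) (Fin n) ℝ)ˣ)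
  have h3 := HasFDerivAt.comp_hasDerivAt_of_eq (0 : ℝ) h2 h1 (by simp)
  simp only [Matrix.nonsing_inv_eq_ringInverse]
  refine h3.congr_deriv ?_
  rw [neg_apply, ContinuousLinearMap.mulLeftRight_apply, inv_one, Units.val_one, one_mul, mul_one]

/-- With `A = g⁻¹h`, `K = g⁻¹k`, `L = g⁻¹l`, the factorization `g + th = g(1 + tA)` turns the
integrand of `g_E(k,l)` at `g + th`, relative to `dV_g`, into this function. -/
theorem hasDerivAt_trace_mul_sqrt_det (A K L : Matrix (Fin n) (Fin n) ℝ) :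
    HasDerivAt (fun t : ℝ => ((1 + t • A)⁻¹ * K * ((1 + t • A)⁻¹ * L)).trace *
      Real.sqrt (1 + t • A).det)
      (-(A * K * L).trace - (K * A * L).trace + 1 / 2 * A.trace * (K * L).trace) 0 := by
  have hinv := hasDerivAt_inv_one_add_smul A
  have hprod := (hinv.mul_const K).mul (hinv.mul_const L)
  have htr : HasDerivAt (fun t : ℝ => ((1 + t • A)⁻¹ * K * ((1 + t • A)⁻¹ * L)).trace)
      (-A * K * ((1 + (0 : ℝ) • A)⁻¹ * L) + (1 + (0 : ℝ) • A)⁻¹ * K * (-A * L)).trace 0 :=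
    (Matrix.traceLinearMap (Fin n) ℝ ℝ).toContinuousLinearMap.hasFDerivAt.comp_hasDerivAt
    (0 : ℝ) hprod
  have hdet := (hasDerivAt_det_one_add_smul A).sqrt (by simp)
  refine (htr.mul hdet).congr_deriv ?_
  simp [Matrix.mul_assoc]
  ring

theorem hasDerivAt_sqrt_det (A : Matrix (Fin n) (Fin n) ℝ) :
    HasDerivAt (fun t : ℝ => Real.sqrt (1 + t • A).det) (1 / 2 * A.trace) 0 := by
  refine ((hasDerivAt_det_one_add_smul A).sqrt (by simp)).congr_deriv ?_
  simp
  ring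

end MatrixCalculus

/-! ### Lines through a metric stay in the cone of metrics for small time -/

section Openness

variable {n : ℕ} {M : Type*} [TopologicalSpace M]
  [ChartedSpace (EuclideanSpace ℝ (Fin n)) M] [IsManifold (𝓡 n) ∞ M]

/-- Positivity on the unit sphere of coordinate vectors persists under small changes of time and
point, because the sphere is compact; homogeneity extends it to all nonzero vectors. -/
theorem eventually_pos_nhds {g : SymTensor n M} (hg : g ∈ metrics n M) (h : SymTensor n M) (x : M) :
    ∀ᶠ z : ℝ × M in 𝓝 (0, x), ∀ v : TangentSpace (𝓡 n) z.2, v ≠ 0 → 0 < (g + z.1 • h) z.2 v v := by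
  have hx := mem_chart_source (EuclideanSpace ℝ (Fin n)) x
  have hcont : ∀ u : Fin n → ℝ, ContinuousAt (fun z : (ℝ × M) × (Fin n → ℝ) =>
      z.2 ⬝ᵥ (gramMatrix (g + z.1.1 • h) x z.1.2).mulVec z.2) ((0, x), u) := by
    intro u
    simp only [dotProduct, Matrix.mulVec, gramMatrix_add, gramMatrix_smul, Matrix.add_apply,
      Matrix.smul_apply, smul_eq_mul]
    have hG : ∀ (k : SymTensor n M) a b, ContinuousAt (fun z : (ℝ × M) × (Fin n → ℝ) =>
        gramMatrix k x z.1.2 a b) ((0, x), u) := fun k a b =>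
      ContinuousAt.comp (g := fun y => gramMatrix k x y a b)
        (f := fun z : (ℝ × M) × (Fin n → ℝ) => z.1.2)
        (smoothMatrixAt_gramMatrix k hx a b).continuousAt (by fun_prop)
    have hu : ∀ a, ContinuousAt (fun z : (ℝ × M) × (Fin n → ℝ) => z.2 a) ((0, x), u) :=
      fun a => by fun_prop
    have ht : ContinuousAt (fun z : (ℝ × M) × (Fin n → ℝ) => z.1.1) ((0, x), u) := by fun_prop
    exact tendsto_finsetSum _ fun a _ => (hu a).mul (tendsto_finsetSum _ fun b _ =>
      ((hG g a b).add (ht.mul (hG h a b))).mul (hu b))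
  have hsphere : ∀ᶠ z : ℝ × M in 𝓝 (0, x), ∀ u ∈ Metric.sphere (0 : Fin n → ℝ) 1,
      0 < u ⬝ᵥ (gramMatrix (g + z.1 • h) x z.2).mulVec u := by
    refine (isCompact_sphere (0 : Fin n → ℝ) 1).eventually_forall_of_forall_eventually
      fun u hu => ?_
    refine (hcont u).eventually (lt_mem_nhds ?_)
    have hu0 : u ≠ 0 := ne_zero_of_mem_unit_sphere ⟨u, hu⟩
    have hp := (gramMatrix_posDef hg hx).dotProduct_mulVec_pos hu0
    simpa using hp
  filter_upwards [hsphere, continuous_snd.continuousAt.eventually_mem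
    ((chartAt (EuclideanSpace ℝ (Fin n)) x).open_source.mem_nhds hx)] with z hz hzx v hv
  set u := (coordBasis x z.2 hzx).equivFun v with hu
  have hu0 : u ≠ 0 := (LinearEquiv.map_ne_zero_iff _).2 hv
  have hn : 0 < ‖u‖ := norm_pos_iff.2 hu0
  have h1 := hz (‖u‖⁻¹ • u) (by simp [norm_smul, hn.ne'])
  rw [gramMatrix_dotProduct hzx, map_smul, hu, LinearEquiv.symm_apply_apply] at h1
  simp only [map_smul, smul_apply, smul_eq_mul] at h1
  have h2 : 0 < ‖u‖⁻¹ := inv_pos.2 hn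
  exact pos_of_mul_pos_right (pos_of_mul_pos_right h1 h2.le) h2.le

theorem eventually_mem_metrics [CompactSpace M] {g : SymTensor n M} (hg : g ∈ metrics n M)
    (h : SymTensor n M) : ∀ᶠ t : ℝ in 𝓝 0, g + t • h ∈ metrics n M := by
  have := (isCompact_univ (X := M)).eventually_forall_of_forall_eventually
    (P := fun (t : ℝ) x => ∀ v : TangentSpace (𝓡 n) x, v ≠ 0 → 0 < (g + t • h) x v v) (x₀ := 0)
    fun x _ => eventually_pos_nhds hg h x
  filter_upwards [this] with t ht x v hv using ht x (Set.mem_univ x) v hv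

/-- A smooth curve of metrics that agrees with a given line near `0`. -/
theorem exists_smoothCurve_eq_line [CompactSpace M] {g : SymTensor n M} (hg : g ∈ metrics n M)
    (h : SymTensor n M) : ∃ c : ℝ → SymTensor n M, IsSmoothCurve c ∧ (∀ t, c t ∈ metrics n M) ∧
      ∀ᶠ t in 𝓝 (0 : ℝ), c t = g + t • h := by
  obtain ⟨ε, hε, hball⟩ := Metric.eventually_nhds_iff.1 (eventually_mem_metrics hg h)
  -- The cut-off time `f(t) t` equals `t` near `0` and always has absolute value below `ε`, so the
  -- curve consists of metrics for all `t`, as `IsLeviCivita.smooth` requires.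
  let f : ContDiffBump (0 : ℝ) := ⟨ε / 2, ε, by linarith, by linarith⟩
  refine ⟨fun t => g + (f t * t) • h,
    (isSmoothCurve_const g).add (IsSmoothCurve.smul (f.contDiff.mul contDiff_id)
      (isSmoothCurve_const h)), fun t => hball ?_, ?_⟩
  · rw [dist_zero_right]
    by_cases ht : dist t 0 < ε
    · rw [dist_zero_right] at ht
      rw [norm_mul, Real.norm_of_nonneg f.nonneg]
      exact (mul_le_of_le_one_left (norm_nonneg t) f.le_one).trans_lt ht
    · rw [f.zero_of_le_dist (not_lt.1 ht)]
      simpa using hε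
  · filter_upwards [f.eventuallyEq_one] with t ht
    rw [ht, Pi.one_apply, one_mul]

end Openness

/-! ### Algebra and definiteness of the Ebin metric -/

section EbinMetric

variable {n : ℕ} {M : Type*} [TopologicalSpace M]
  [ChartedSpace (EuclideanSpace ℝ (Fin n)) M] [IsManifold (𝓡 n) ∞ M]

theorem sharp_add (g h h' : SymTensor n M) (x : M) :
    sharp g (h + h') x = sharp g h x + sharp g h' x := by
  ext v
  simp [sharp, SymTensor.add_apply]

theorem sharp_smul (g : SymTensor n M) (r : ℝ) (h : SymTensor n M) (x : M) :
    sharp g (r • h) x = r • sharp g h x := by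
  ext v
  simp [sharp, SymTensor.smul_apply]

theorem trPair_comm (g h k : SymTensor n M) (x : M) : trPair g h k x = trPair g k h x :=
  LinearMap.trace_mul_comm ℝ _ _

theorem trPair_add_left (g h h' k : SymTensor n M) (x : M) :
    trPair g (h + h') k x = trPair g h k x + trPair g h' k x := by
  rw [trPair, sharp_add, ContinuousLinearMap.add_comp, ContinuousLinearMap.toLinearMap_add, map_add]
  rfl

theorem trPair_smul_left (g : SymTensor n M) (r : ℝ) (h k : SymTensor n M) (x : M) :
    trPair g (r • h) k x = r * trPair g h k x := by
  rw [trPair, sharp_smul, ContinuousLinearMap.smul_comp, ContinuousLinearMap.toLinearMap_smul, map_smul]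
  rfl

theorem trPair_add_right (g h k k' : SymTensor n M) (x : M) :
    trPair g h (k + k') x = trPair g h k x + trPair g h k' x := by
  rw [trPair_comm, trPair_add_left, trPair_comm g k, trPair_comm g k']

theorem trPair_smul_right (g : SymTensor n M) (r : ℝ) (h k : SymTensor n M) (x : M) :
    trPair g h (r • k) x = r * trPair g h k x := by
  rw [trPair_comm, trPair_smul_left, trPair_comm g k]

theorem trPair_self_self {g : SymTensor n M} (hg : g ∈ metrics n M) (x : M) :
    trPair g g g x = n := by
  have hx := mem_chart_source (EuclideanSpace ℝ (Fin n)) x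
  rw [trPair_eq hg hx, Matrix.nonsing_inv_mul _ (gramMatrix_isUnit_det hg hx)]
  simp

theorem trPair_metric {g : SymTensor n M} (hg : g ∈ metrics n M) (h : SymTensor n M) {i x : M}
    (hx : x ∈ (chartAt (EuclideanSpace ℝ (Fin n)) i).source) :
    trPair g g h x = ((gramMatrix g i x)⁻¹ * gramMatrix h i x).trace := by
  rw [trPair_eq hg hx, Matrix.nonsing_inv_mul _ (gramMatrix_isUnit_det hg hx), one_mul]

theorem continuous_trPair {g : SymTensor n M} (hg : g ∈ metrics n M) (h k : SymTensor n M) :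
    Continuous (trPair g h k) := by
  have hm : ∀ t : ℝ, (fun _ : ℝ => g) t ∈ metrics n M := fun _ => hg
  have hF := contMDiff_trPair (isSmoothCurve_const g) hm (isSmoothCurve_const h)
    (isSmoothCurve_const k)
  have hc := hF.continuous.comp (by fun_prop : Continuous fun x : M => ((0 : ℝ), x))
  simpa only [Function.comp_def] using hc

variable [CompactSpace M] [T2Space M]

theorem ebin_comm (g h k : SymTensor n M) : ebin g h k = ebin g k h := by
  rw [ebin, ebin, funext (trPair_comm g h k)]

theorem ebin_add_left {g : SymTensor n M} (hg : g ∈ metrics n M) (h h' k : SymTensor n M) :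
    ebin g (h + h') k = ebin g h k + ebin g h' k := by
  rw [ebin, funext (trPair_add_left g h h' k),
    volIntegral_add g (continuous_trPair hg h k) (continuous_trPair hg h' k)]
  rfl

theorem ebin_smul_left (g : SymTensor n M) (r : ℝ) (h k : SymTensor n M) :
    ebin g (r • h) k = r * ebin g h k := by
  rw [ebin, funext (trPair_smul_left g r h k), volIntegral_const_mul]
  rfl

theorem ebin_add_right {g : SymTensor n M} (hg : g ∈ metrics n M) (h k k' : SymTensor n M) :
    ebin g h (k + k') = ebin g h k + ebin g h k' := by
  rw [ebin_comm, ebin_add_left hg, ebin_comm g k, ebin_comm g k']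

theorem ebin_smul_right (g : SymTensor n M) (r : ℝ) (h k : SymTensor n M) :
    ebin g h (r • k) = r * ebin g h k := by
  rw [ebin_comm, ebin_smul_left, ebin_comm g k]

theorem ebin_neg_left (g h k : SymTensor n M) : ebin g (-h) k = -ebin g h k := by
  rw [← neg_one_smul ℝ h, ebin_smul_left, neg_one_mul]

theorem ebin_sub_left {g : SymTensor n M} (hg : g ∈ metrics n M) (h h' k : SymTensor n M) :
    ebin g (h - h') k = ebin g h k - ebin g h' k := by
  rw [sub_eq_add_neg, ebin_add_left hg, ebin_neg_left, sub_eq_add_neg]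

theorem ebin_sub_right {g : SymTensor n M} (hg : g ∈ metrics n M) (h k k' : SymTensor n M) :
    ebin g h (k - k') = ebin g h k - ebin g h k' := by
  rw [ebin_comm, ebin_sub_left hg, ebin_comm g k, ebin_comm g k']

theorem ebin_self_self {g : SymTensor n M} (hg : g ∈ metrics n M) :
    ebin g g g = n * vol g := by
  rw [ebin, vol, ← volIntegral_const_mul, mul_one, funext (trPair_self_self hg)]

theorem eq_zero_of_ebin_self {g : SymTensor n M} (hg : g ∈ metrics n M) {h : SymTensor n M}
    (h0 : ebin g h h = 0) : h = 0 := by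
  refine SymTensor.ext fun x => ?_
  by_contra hne
  have hpos : 0 < trPair g h h x :=
    lt_of_le_of_ne (trPair_self hg h x).1 fun h => hne ((trPair_self hg _ x).2 h.symm)
  exact (volIntegral_pos hg (continuous_trPair hg h h) (fun y => (trPair_self hg h y).1) hpos).ne' h0

theorem vol_pos [Nonempty M] {g : SymTensor n M} (hg : g ∈ metrics n M) : 0 < vol g :=
  volIntegral_pos hg continuous_const (fun _ => zero_le_one) (x := Classical.arbitrary M) one_pos

end EbinMetric

/-! ### First variation of the volume and of the Ebin metric -/

section Variation

variable {n : ℕ} {M : Type*} [TopologicalSpace M]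
  [ChartedSpace (EuclideanSpace ℝ (Fin n)) M] [IsManifold (𝓡 n) ∞ M] [CompactSpace M] [T2Space M]
  {c a b : ℝ → SymTensor n M}

/-- The measure of `c 0` is kept fixed and all time dependence moves into the integrand through the
density ratio. -/
theorem contDiff_volIntegral (hc : IsSmoothCurve c) (hm : ∀ t, c t ∈ metrics n M) {f : ℝ × M → ℝ}
    (hf : ContMDiff (𝓘(ℝ, ℝ).prod (𝓡 n)) 𝓘(ℝ, ℝ) ∞ f) :
    ContDiff ℝ ∞ fun t => volIntegral (c t) fun x => f (t, x) := by
  borelize M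
  have : IsManifold (𝓡 n) 1 M := IsManifold.of_le (n := ∞) (by simp)
  obtain ⟨μ, hμ, hint⟩ := exists_measure_volIntegral (c 0)
  have hF : ContMDiff (𝓘(ℝ, ℝ).prod (𝓡 n)) 𝓘(ℝ, ℝ) ∞
      (fun q : ℝ × M => f q * densityRatio (c 0) (c q.1) q.2) :=
    hf.mul (contMDiff_densityRatio hc hm (hm 0))
  convert! contDiff_integral_of_contMDiff μ hF using 2 with t
  exact (volIntegral_eq_densityRatio (hm 0) _ _).trans (hint _
    (hF.continuous.comp (by fun_prop : Continuous fun x : M => (t, x))))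

theorem hasDerivAt_volIntegral (hc : IsSmoothCurve c) (hm : ∀ t, c t ∈ metrics n M) {f : ℝ × M → ℝ}
    (hf : ContMDiff (𝓘(ℝ, ℝ).prod (𝓡 n)) 𝓘(ℝ, ℝ) ∞ f) :
    HasDerivAt (fun t => volIntegral (c t) fun x => f (t, x))
      (volIntegral (c 0) fun x => deriv (fun t => f (t, x) * densityRatio (c 0) (c t) x) 0) 0 := by
  borelize M
  have : IsManifold (𝓡 n) 1 M := IsManifold.of_le (n := ∞) (by simp)
  obtain ⟨μ, hμ, hint⟩ := exists_measure_volIntegral (c 0)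
  have hF : ContMDiff (𝓘(ℝ, ℝ).prod (𝓡 n)) 𝓘(ℝ, ℝ) ∞
      (fun q : ℝ × M => f q * densityRatio (c 0) (c q.1) q.2) :=
    hf.mul (contMDiff_densityRatio hc hm (hm 0))
  have hF' : Continuous fun x : M => deriv (fun t => f (t, x) * densityRatio (c 0) (c t) x) 0 :=
    continuous_iff_continuousAt.2 fun x =>
      (contMDiffAt_deriv_fst (hF (0, x))).continuousAt.comp (f := fun x : M => ((0 : ℝ), x))
        (by fun_prop)
  rw [hint _ hF']
  convert! hasDerivAt_integral_of_contMDiff μ hF 0 using 1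
  funext t
  exact (volIntegral_eq_densityRatio (hm 0) _ _).trans (hint _
    (hF.continuous.comp (by fun_prop : Continuous fun x : M => (t, x))))

theorem contDiff_vol (hc : IsSmoothCurve c) (hm : ∀ t, c t ∈ metrics n M) :
    ContDiff ℝ ∞ fun t => vol (c t) :=
  contDiff_volIntegral hc hm (f := fun _ => 1) contMDiff_const

theorem contDiff_ebin (hc : IsSmoothCurve c) (hm : ∀ t, c t ∈ metrics n M) (ha : IsSmoothCurve a)
    (hb : IsSmoothCurve b) : ContDiff ℝ ∞ fun t => ebin (c t) (a t) (b t) :=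
  contDiff_volIntegral hc hm (contMDiff_trPair hc hm ha hb)

omit [CompactSpace M] [T2Space M] in
theorem inv_mul_gramMatrix_add_smul {g : SymTensor n M} (hg : g ∈ metrics n M) (h : SymTensor n M)
    {i x : M} (hx : x ∈ (chartAt (EuclideanSpace ℝ (Fin n)) i).source) (t : ℝ) :
    gramMatrix (g + t • h) i x =
      gramMatrix g i x * (1 + t • ((gramMatrix g i x)⁻¹ * gramMatrix h i x)) := by
  rw [Matrix.mul_add, mul_one, Matrix.mul_smul,
    Matrix.mul_nonsing_inv_cancel_left _ _ (gramMatrix_isUnit_det hg hx)]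
  rfl

omit [CompactSpace M] [T2Space M] in
theorem densityRatio_line {g : SymTensor n M} (hg : g ∈ metrics n M) (h : SymTensor n M)
    {i x : M} (hx : x ∈ (chartAt (EuclideanSpace ℝ (Fin n)) i).source) (t : ℝ) :
    densityRatio g (g + t • h) x =
      Real.sqrt (1 + t • ((gramMatrix g i x)⁻¹ * gramMatrix h i x)).det := by
  rw [densityRatio_eq hg hx, inv_mul_gramMatrix_add_smul hg h hx,
    Matrix.nonsing_inv_mul_cancel_left _ _ (gramMatrix_isUnit_det hg hx)]

theorem hasDerivAt_vol {g : SymTensor n M} (hg : g ∈ metrics n M) (h : SymTensor n M) :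
    HasDerivAt (fun t : ℝ => vol (g + t • h)) (1 / 2 * ebin g g h) 0 := by
  obtain ⟨c, hc, hm, hev⟩ := exists_smoothCurve_eq_line hg h
  have hc0 : c 0 = g := by simpa using hev.self_of_nhds
  have h1 := hasDerivAt_volIntegral hc hm (f := fun _ => 1) contMDiff_const
  refine (h1.congr_of_eventuallyEq ?_).congr_deriv ?_
  · filter_upwards [hev] with t ht
    rw [ht, vol]
  · rw [hc0, ebin, ← volIntegral_const_mul]
    congr 1
    funext x
    have hx := mem_chart_source (EuclideanSpace ℝ (Fin n)) x
    refine HasDerivAt.deriv (((hasDerivAt_sqrt_det ((gramMatrix g x x)⁻¹ * gramMatrix h x x)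
      ).congr_of_eventuallyEq ?_).congr_deriv ?_)
    · filter_upwards [hev] with t ht
      rw [ht, densityRatio_line hg h hx, one_mul]
    · rw [trPair_metric hg h hx]

/-- The integrand enters as a function `D` with prescribed values so that it can be supplied in the
form that metric compatibility needs. -/
theorem hasDerivAt_ebin_of_pointwise {g : SymTensor n M} (hg : g ∈ metrics n M)
    (h k l : SymTensor n M) {D : M → ℝ}
    (hD : ∀ x, D x =
      -((gramMatrix g x x)⁻¹ * gramMatrix h x x * ((gramMatrix g x x)⁻¹ * gramMatrix k x x) *
          ((gramMatrix g x x)⁻¹ * gramMatrix l x x)).trace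
        - ((gramMatrix g x x)⁻¹ * gramMatrix k x x * ((gramMatrix g x x)⁻¹ * gramMatrix h x x) *
          ((gramMatrix g x x)⁻¹ * gramMatrix l x x)).trace
        + 1 / 2 * ((gramMatrix g x x)⁻¹ * gramMatrix h x x).trace *
          ((gramMatrix g x x)⁻¹ * gramMatrix k x x *
            ((gramMatrix g x x)⁻¹ * gramMatrix l x x)).trace) :
    HasDerivAt (fun t : ℝ => ebin (g + t • h) k l) (volIntegral g D) 0 := by
  obtain ⟨c, hc, hm, hev⟩ := exists_smoothCurve_eq_line hg h
  have hc0 : c 0 = g := by simpa using hev.self_of_nhds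
  have h1 := hasDerivAt_volIntegral hc hm
    (contMDiff_trPair hc hm (isSmoothCurve_const k) (isSmoothCurve_const l))
  refine (h1.congr_of_eventuallyEq ?_).congr_deriv ?_
  · filter_upwards [hev] with t ht
    rw [ht, ebin]
  · rw [hc0]
    congr 1
    funext x
    have hx := mem_chart_source (EuclideanSpace ℝ (Fin n)) x
    rw [hD x]
    refine HasDerivAt.deriv ((hasDerivAt_trace_mul_sqrt_det ((gramMatrix g x x)⁻¹ * gramMatrix h x x)
      _ _).congr_of_eventuallyEq ?_)
    filter_upwards [hev] with t ht
    have hgt : g + t • h ∈ metrics n M := ht ▸ hm t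
    simp only [ht]
    rw [densityRatio_line hg h hx, trPair_eq hgt hx, inv_mul_gramMatrix_add_smul hg h hx,
      Matrix.mul_inv_rev]
    simp only [Matrix.mul_assoc]

end Variation

/-! ### Explicit Levi-Civita connections of `g_E` and `g_p` -/

section Christoffel

variable {n : ℕ} {M : Type*} [TopologicalSpace M]
  [ChartedSpace (EuclideanSpace ℝ (Fin n)) M] [IsManifold (𝓡 n) ∞ M]

/-- The bilinear form `-(h g⁻¹ k + k g⁻¹ h) / 2 + (tr(g⁻¹h) k + tr(g⁻¹k) h - tr(g⁻¹hg⁻¹k) g) / 4`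
on `T_x M`. -/
def ebinForm (g h k : SymTensor n M) (x : M) :
    TangentSpace (𝓡 n) x →L[ℝ] TangentSpace (𝓡 n) x →L[ℝ] ℝ :=
  (-1 / 2 : ℝ) • (formProd g h k x + formProd g k h x) +
    (1 / 4 : ℝ) • (trPair g g h x • k x + trPair g g k x • h x + (-trPair g h k x) • g x)

theorem formMatrix_ebinForm {g : SymTensor n M} (hg : g ∈ metrics n M) (h k : SymTensor n M)
    {i x : M} (hx : x ∈ (chartAt (EuclideanSpace ℝ (Fin n)) i).source) :
    formMatrix i x (ebinForm g h k x) =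
      (-1 / 2 : ℝ) • (gramMatrix h i x * ((gramMatrix g i x)⁻¹ * gramMatrix k i x) +
        gramMatrix k i x * ((gramMatrix g i x)⁻¹ * gramMatrix h i x)) +
      (1 / 4 : ℝ) • (trPair g g h x • gramMatrix k i x + trPair g g k x • gramMatrix h i x +
        (-trPair g h k x) • gramMatrix g i x) := by
  rw [← formMatrix_formProd hg hx, ← formMatrix_formProd hg hx]
  rfl

/-- The transpose of `h g⁻¹ k` is `k g⁻¹ h`, which is why `ebinForm` contains their sum. -/
theorem formProd_swap {g : SymTensor n M} (hg : g ∈ metrics n M) (h k : SymTensor n M) (x : M)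
    (v w : TangentSpace (𝓡 n) x) : formProd g h k x v w = formProd g k h x w v := by
  rw [formProd_apply, formProd_apply, ← apply_sharp hg h x v, ← apply_sharp hg k x w, g.symm]

theorem ebinForm_symm {g : SymTensor n M} (hg : g ∈ metrics n M) (h k : SymTensor n M) (x : M)
    (v w : TangentSpace (𝓡 n) x) : ebinForm g h k x v w = ebinForm g h k x w v := by
  simp only [ebinForm, _root_.add_apply, _root_.smul_apply, formProd_swap hg k h x v w,
    formProd_swap hg h k x v w, h.symm x v w, k.symm x v w, g.symm x v w]
  rw [add_comm (formProd g k h x w v)]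

theorem smoothMatrixAt_ebinForm {c a b : ℝ → SymTensor n M} (hc : IsSmoothCurve c)
    (hm : ∀ t, c t ∈ metrics n M) (ha : IsSmoothCurve a) (hb : IsSmoothCurve b) (q : ℝ × M) :
    SmoothMatrixAt (𝓘(ℝ, ℝ).prod (𝓡 n))
      (fun y : ℝ × M => formMatrix q.2 y.2 (ebinForm (c y.1) (a y.1) (b y.1) y.2)) q := by
  have hC := isSmoothCurve_iff.1 hc q
  have hA := isSmoothCurve_iff.1 ha q
  have hB := isSmoothCurve_iff.1 hb q
  have hinv := hC.inv (gramMatrix_isUnit_det (hm q.1) (mem_chart_source _ q.2)).ne_zero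
  have hS := (SmoothMatrixAt.smul (contMDiffAt_const (c := (-1 / 2 : ℝ)))
    ((hA.mul (hinv.mul hB)).add (hB.mul (hinv.mul hA)))).add
    (SmoothMatrixAt.smul (contMDiffAt_const (c := (1 / 4 : ℝ)))
      (((SmoothMatrixAt.smul (contMDiff_trPair hc hm hc ha q) hB).add
        (SmoothMatrixAt.smul (contMDiff_trPair hc hm hc hb q) hA)).add
        (SmoothMatrixAt.smul (contMDiff_trPair hc hm ha hb q).neg hC)))
  intro i j
  refine (hS i j).congr_of_eventuallyEq ?_
  filter_upwards [continuous_snd.continuousAt.eventually_mem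
    ((chartAt (EuclideanSpace ℝ (Fin n)) q.2).open_source.mem_nhds (mem_chart_source _ q.2))]
    with y hy
  rw [formMatrix_ebinForm (hm y.1) _ _ hy]

theorem smoothMatrixAt_ebinForm_const {g : SymTensor n M} (hg : g ∈ metrics n M)
    (h k : SymTensor n M) (x : M) :
    SmoothMatrixAt (𝓡 n) (fun y : M => formMatrix x y (ebinForm g h k y)) x := by
  intro i j
  have hm : ∀ t : ℝ, (fun _ : ℝ => g) t ∈ metrics n M := fun _ => hg
  have hS := smoothMatrixAt_ebinForm (isSmoothCurve_const g) hm (isSmoothCurve_const h)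
    (isSmoothCurve_const k) ((0 : ℝ), x) i j
  have hx : ContMDiffAt (𝓡 n) (𝓘(ℝ, ℝ).prod (𝓡 n)) ∞ (fun y : M => ((0 : ℝ), y)) x :=
    contMDiffAt_const.prodMk contMDiffAt_id
  have hcomp := ContMDiffAt.comp x hS hx
  simpa only [Function.comp_def] using hcomp

/-- The Christoffel map of the Ebin metric. -/
def ebinChristoffel {g : SymTensor n M} (hg : g ∈ metrics n M) (h k : SymTensor n M) :
    SymTensor n M :=
  SymTensor.mk' (ebinForm g h k) (ebinForm_symm hg h k) (smoothMatrixAt_ebinForm_const hg h k)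

variable {g : SymTensor n M} (hg : g ∈ metrics n M)

theorem ebinChristoffel_apply (h k : SymTensor n M) (x : M) :
    ebinChristoffel hg h k x = ebinForm g h k x := rfl

theorem ebinChristoffel_comm (h k : SymTensor n M) :
    ebinChristoffel hg h k = ebinChristoffel hg k h := by
  refine SymTensor.ext fun x => ?_
  rw [ebinChristoffel_apply, ebinChristoffel_apply, ebinForm, ebinForm, trPair_comm g h k,
    add_comm (formProd g h k x), add_comm (trPair g g h x • k x)]

theorem formProd_add_left (h h' k : SymTensor n M) (x : M) :
    formProd g (h + h') k x = formProd g h k x + formProd g h' k x := by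
  ext v w; rfl

theorem formProd_smul_left (r : ℝ) (h k : SymTensor n M) (x : M) :
    formProd g (r • h) k x = r • formProd g h k x := by
  ext v w; rfl

theorem formProd_add_right (h k k' : SymTensor n M) (x : M) :
    formProd g h (k + k') x = formProd g h k x + formProd g h k' x := by
  ext v w
  simp only [formProd_apply, sharp_add, _root_.add_apply, map_add]

theorem formProd_smul_right (r : ℝ) (h k : SymTensor n M) (x : M) :
    formProd g h (r • k) x = r • formProd g h k x := by
  ext v w
  simp only [formProd_apply, sharp_smul, _root_.smul_apply, map_smul]

theorem ebinChristoffel_add_left (h h' k : SymTensor n M) :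
    ebinChristoffel hg (h + h') k = ebinChristoffel hg h k + ebinChristoffel hg h' k := by
  refine SymTensor.ext fun x => ?_
  rw [SymTensor.add_apply]
  simp only [ebinChristoffel_apply, ebinForm, formProd_add_left, formProd_add_right,
    trPair_add_left, trPair_add_right, SymTensor.add_apply]
  ext v w
  simp only [_root_.add_apply, _root_.smul_apply, smul_eq_mul]
  ring

theorem ebinChristoffel_smul_left (r : ℝ) (h k : SymTensor n M) :
    ebinChristoffel hg (r • h) k = r • ebinChristoffel hg h k := by
  refine SymTensor.ext fun x => ?_
  rw [SymTensor.smul_apply]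
  simp only [ebinChristoffel_apply, ebinForm, formProd_smul_left, formProd_smul_right,
    trPair_smul_left, trPair_smul_right, SymTensor.smul_apply]
  ext v w
  simp only [_root_.add_apply, _root_.smul_apply, smul_eq_mul]
  ring

/-- Adding the derivative `h` of the tautological field gives `∇_h g = (n/4) h`, the identity that
makes the Hessian of `V` pure trace. -/
theorem ebinChristoffel_self_right (h : SymTensor n M) :
    ebinChristoffel hg h g = ((n : ℝ) / 4 - 1) • h := by
  refine SymTensor.ext fun x => ?_
  have hx := mem_chart_source (EuclideanSpace ℝ (Fin n)) x
  have hu := gramMatrix_isUnit_det hg hx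
  refine form_ext_matrix x x hx ?_
  have h1 : formMatrix x x ((((n : ℝ) / 4 - 1) • h : SymTensor n M) x) =
    ((n : ℝ) / 4 - 1) • gramMatrix h x x := rfl
  rw [h1, ebinChristoffel_apply, formMatrix_ebinForm hg _ _ hx, Matrix.nonsing_inv_mul _ hu,
    Matrix.mul_nonsing_inv_cancel_left _ _ hu, trPair_self_self hg, trPair_comm g h g, mul_one]
  module

theorem inv_mul_gramMatrix_ebinChristoffel (h k : SymTensor n M) {i x : M}
    (hx : x ∈ (chartAt (EuclideanSpace ℝ (Fin n)) i).source) :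
    (gramMatrix g i x)⁻¹ * gramMatrix (ebinChristoffel hg h k) i x =
      (-1 / 2 : ℝ) • ((gramMatrix g i x)⁻¹ * gramMatrix h i x *
          ((gramMatrix g i x)⁻¹ * gramMatrix k i x) +
        (gramMatrix g i x)⁻¹ * gramMatrix k i x * ((gramMatrix g i x)⁻¹ * gramMatrix h i x)) +
      (1 / 4 : ℝ) • (trPair g g h x • ((gramMatrix g i x)⁻¹ * gramMatrix k i x) +
        trPair g g k x • ((gramMatrix g i x)⁻¹ * gramMatrix h i x) +
        (-trPair g h k x) • (1 : Matrix (Fin n) (Fin n) ℝ)) := by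
  rw [show gramMatrix (ebinChristoffel hg h k) i x = formMatrix i x (ebinForm g h k x) from rfl,
    formMatrix_ebinForm hg _ _ hx]
  simp only [Matrix.mul_add, Matrix.mul_smul, Matrix.mul_assoc,
    Matrix.nonsing_inv_mul _ (gramMatrix_isUnit_det hg hx)]

/-- Pointwise metric compatibility. By cyclicity of the trace the cubic terms combine, and among the
products of traces only `tr A · tr (KL)` survives the sum over the two slots. -/
theorem trPair_ebinChristoffel (h k l : SymTensor n M) (x : M) :
    trPair g (ebinChristoffel hg h k) l x + trPair g k (ebinChristoffel hg h l) x =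
      -((gramMatrix g x x)⁻¹ * gramMatrix h x x * ((gramMatrix g x x)⁻¹ * gramMatrix k x x) *
          ((gramMatrix g x x)⁻¹ * gramMatrix l x x)).trace
        - ((gramMatrix g x x)⁻¹ * gramMatrix k x x * ((gramMatrix g x x)⁻¹ * gramMatrix h x x) *
          ((gramMatrix g x x)⁻¹ * gramMatrix l x x)).trace
        + 1 / 2 * ((gramMatrix g x x)⁻¹ * gramMatrix h x x).trace *
          ((gramMatrix g x x)⁻¹ * gramMatrix k x x *
            ((gramMatrix g x x)⁻¹ * gramMatrix l x x)).trace := by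
  have hx := mem_chart_source (EuclideanSpace ℝ (Fin n)) x
  rw [trPair_eq hg hx, trPair_eq hg hx, inv_mul_gramMatrix_ebinChristoffel hg _ _ hx,
    inv_mul_gramMatrix_ebinChristoffel hg _ _ hx]
  simp only [trPair_metric hg _ hx, trPair_eq hg hx h]
  generalize (gramMatrix g x x)⁻¹ * gramMatrix h x x = A
  generalize (gramMatrix g x x)⁻¹ * gramMatrix k x x = K
  generalize (gramMatrix g x x)⁻¹ * gramMatrix l x x = L
  have h1 : (K * (L * A)).trace = (A * K * L).trace := by
    rw [← Matrix.mul_assoc, Matrix.trace_mul_comm, Matrix.mul_assoc]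
  have h2 : (K * (A * L)).trace = (K * A * L).trace := by rw [Matrix.mul_assoc]
  have h3 : (K * A).trace = (A * K).trace := Matrix.trace_mul_comm _ _
  simp only [Matrix.add_mul, Matrix.mul_add, Matrix.smul_mul, Matrix.mul_smul, Matrix.trace_add,
    Matrix.trace_smul, smul_eq_mul, one_mul, mul_one, h1, h2, h3]
  ring

variable [CompactSpace M] [T2Space M]

theorem hasDerivAt_ebin (h k l : SymTensor n M) :
    HasDerivAt (fun t : ℝ => ebin (g + t • h) k l)
      (ebin g (ebinChristoffel hg h k) l + ebin g k (ebinChristoffel hg h l)) 0 := by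
  have := hasDerivAt_ebin_of_pointwise hg h k l (trPair_ebinChristoffel hg h k l)
  rwa [volIntegral_add g (continuous_trPair hg _ _) (continuous_trPair hg _ _)] at this

/-- The Christoffel map of `g_p` at a metric `g`. -/
def ebinPChristoffel (p : ℝ) (h k : SymTensor n M) : SymTensor n M :=
  ebinChristoffel hg h k +
    (-p / (4 * vol g)) • (ebin g g h • k + ebin g g k • h - ebin g h k • g)

theorem ebinPChristoffel_comm (p : ℝ) (h k : SymTensor n M) :
    ebinPChristoffel hg p h k = ebinPChristoffel hg p k h := by
  rw [ebinPChristoffel, ebinPChristoffel, ebinChristoffel_comm, ebin_comm g h k,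
    add_comm (ebin g g h • k)]

theorem ebinPChristoffel_add_left (p : ℝ) (h h' k : SymTensor n M) :
    ebinPChristoffel hg p (h + h') k =
      ebinPChristoffel hg p h k + ebinPChristoffel hg p h' k := by
  simp only [ebinPChristoffel, ebinChristoffel_add_left, ebin_add_left hg, ebin_add_right hg]
  module

theorem ebinPChristoffel_smul_left (p r : ℝ) (h k : SymTensor n M) :
    ebinPChristoffel hg p (r • h) k = r • ebinPChristoffel hg p h k := by
  simp only [ebinPChristoffel, ebinChristoffel_smul_left, ebin_smul_left, ebin_smul_right]
  module

open Classical in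
variable (n M) in
/-- The Christoffel map of `g_p`, extended by zero to tensor fields that are not metrics. -/
def christoffel (p : ℝ) (g : SymTensor n M) : SymTensor n M →ₗ[ℝ] SymTensor n M →ₗ[ℝ] SymTensor n M :=
  if hg : g ∈ metrics n M then
    LinearMap.mk₂ ℝ (ebinPChristoffel hg p) (ebinPChristoffel_add_left hg p)
      (ebinPChristoffel_smul_left hg p)
      (fun h k k' => by
        rw [ebinPChristoffel_comm, ebinPChristoffel_add_left, ebinPChristoffel_comm hg p k,
          ebinPChristoffel_comm hg p k'])
      (fun r h k => by
        rw [ebinPChristoffel_comm, ebinPChristoffel_smul_left, ebinPChristoffel_comm hg p k])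
  else 0

theorem christoffel_eq (p : ℝ) (h k : SymTensor n M) :
    christoffel n M p g h k = ebinPChristoffel hg p h k := by
  rw [christoffel, dif_pos hg, LinearMap.mk₂_apply]

theorem christoffel_zero_eq (h k : SymTensor n M) :
    christoffel n M 0 g h k = ebinChristoffel hg h k := by
  simp [christoffel_eq hg, ebinPChristoffel]

theorem isSmoothCurve_christoffel (p : ℝ) {c a b : ℝ → SymTensor n M} (hc : IsSmoothCurve c)
    (ha : IsSmoothCurve a) (hb : IsSmoothCurve b) (hm : ∀ t, c t ∈ metrics n M) :
    IsSmoothCurve fun t => christoffel n M p (c t) (a t) (b t) := by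
  -- For empty `M` the volume vanishes and cannot be divided by, but there is nothing to prove.
  cases isEmpty_or_nonempty M
  · exact isSmoothCurve_iff.2 fun q => isEmptyElim q.2
  have hE : IsSmoothCurve fun t => ebinChristoffel (hm t) (a t) (b t) :=
    isSmoothCurve_iff.2 (smoothMatrixAt_ebinForm hc hm ha hb)
  have hV : ContDiff ℝ ∞ fun t => -p / (4 * vol (c t)) :=
    contDiff_const.div (contDiff_const.mul (contDiff_vol hc hm)) fun t =>
      (mul_pos four_pos (vol_pos (hm t))).ne'
  have hcorr := IsSmoothCurve.smul hV
    (((IsSmoothCurve.smul (contDiff_ebin hc hm hc ha) hb).add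
      (IsSmoothCurve.smul (contDiff_ebin hc hm hc hb) ha)).add
      (IsSmoothCurve.smul (contDiff_ebin hc hm ha hb).neg hc))
  have heq : (fun t => christoffel n M p (c t) (a t) (b t)) = fun t =>
      ebinChristoffel (hm t) (a t) (b t) + (-p / (4 * vol (c t))) •
        (ebin (c t) (c t) (a t) • b t + ebin (c t) (c t) (b t) • a t +
          (-ebin (c t) (a t) (b t)) • c t) := by
    funext t
    rw [christoffel_eq (hm t), ebinPChristoffel, neg_smul, ← sub_eq_add_neg]
  rw [heq]
  exact hE.add hcorr

omit [CompactSpace M] [T2Space M] in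
theorem SymTensor.eq_zero_of_isEmpty [IsEmpty M] (h : SymTensor n M) : h = 0 :=
  SymTensor.ext fun x => isEmptyElim x

/-- In the sum over the two slots the conformal correction contributes only `-p/(2V) (g,h)(k,l)`,
which matches the derivative of `V^{-p}`; its other terms cancel. -/
theorem hasDerivAt_ebinP [Nonempty M] (p : ℝ) (h k l : SymTensor n M) :
    HasDerivAt (fun t : ℝ => ebinP p (g + t • h) k l)
      (ebinP p g (ebinPChristoffel hg p h k) l + ebinP p g k (ebinPChristoffel hg p h l)) 0 := by
  have hV := vol_pos hg
  have hvol : HasDerivAt (fun t : ℝ => vol (g + t • h) ^ (-p)) _ 0 :=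
    (hasDerivAt_vol hg h).rpow_const (p := -p) (Or.inl (by simpa using hV.ne'))
  refine (hvol.mul (hasDerivAt_ebin hg h k l)).congr_deriv ?_
  simp only [ebinP, ebinPChristoffel, ebin_add_left hg, ebin_add_right hg, ebin_sub_left hg,
    ebin_sub_right hg, ebin_smul_left, ebin_smul_right, zero_smul, add_zero]
  rw [Real.rpow_sub_one hV.ne', ebin_comm g k h, ebin_comm g k g]
  field_simp
  ring

theorem isLeviCivita_christoffel (p : ℝ) :
    IsLeviCivita (n := n) (M := M) (ebinP p) (christoffel n M p) where
  smooth c a b hc ha hb hm := isSmoothCurve_christoffel p hc ha hb hm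
  torsion_free g hg h k := by
    rw [christoffel_eq hg, christoffel_eq hg, ebinPChristoffel_comm]
  metric g hg h k l := by
    rw [christoffel_eq hg, christoffel_eq hg]
    cases isEmpty_or_nonempty M
    · have h0 : ∀ g k l : SymTensor n M, ebinP p g k l = 0 := fun g k l => by
        rw [k.eq_zero_of_isEmpty, ← zero_smul ℝ (0 : SymTensor n M), ebinP, ebin_smul_left]
        simp
      simp only [h0, add_zero]
      exact hasDerivAt_const _ _
    · exact hasDerivAt_ebinP hg p h k l

theorem ebinP_zero : ebinP (n := n) (M := M) 0 = ebin := by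
  funext g h k
  simp [ebinP]

end Christoffel

/-! ### Uniqueness of the Levi-Civita connection -/

section Uniqueness

variable {n : ℕ} {M : Type*} [TopologicalSpace M]
  [ChartedSpace (EuclideanSpace ℝ (Fin n)) M] [IsManifold (𝓡 n) ∞ M] [CompactSpace M] [T2Space M]

/-- The difference of two candidates is symmetric in its arguments and skew after pairing with the
metric, so cycling the three slots forces it to be zero. Only definiteness is needed, so a weak
metric suffices. -/
theorem IsLeviCivita.unique {p : ℝ}
    {C C' : SymTensor n M → SymTensor n M →ₗ[ℝ] SymTensor n M →ₗ[ℝ] SymTensor n M}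
    (hC : IsLeviCivita (ebinP p) C) (hC' : IsLeviCivita (ebinP p) C') {g : SymTensor n M}
    (hg : g ∈ metrics n M) (h k : SymTensor n M) : C g h k = C' g h k := by
  cases isEmpty_or_nonempty M
  · exact SymTensor.ext fun x => isEmptyElim x
  have hP : vol g ^ (-p) ≠ 0 := (Real.rpow_pos_of_pos (vol_pos hg) _).ne'
  have hskew : ∀ a b c, ebin g (C g a b - C' g a b) c = -ebin g (C g a c - C' g a c) b := by
    intro a b c
    have h1 := (hC.metric g hg a b c).unique (hC'.metric g hg a b c)
    simp only [ebinP, ← mul_add] at h1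
    have h2 := mul_left_cancel₀ hP h1
    rw [ebin_comm g b, ebin_comm g b] at h2
    rw [ebin_sub_left hg, ebin_sub_left hg]
    linarith
  have hsymm : ∀ a b, C g a b - C' g a b = C g b a - C' g b a := fun a b => by
    rw [hC.torsion_free g hg a b, hC'.torsion_free g hg a b]
  have hzero : ∀ a b c, ebin g (C g a b - C' g a b) c = 0 := by
    intro a b c
    have h1 := hskew a b c
    rw [hsymm a c] at h1
    have h2 := hskew c a b
    rw [hsymm c b] at h2
    have h3 := hskew b c a
    rw [hsymm b a] at h3
    linarith
  exact sub_eq_zero.1 (eq_zero_of_ebin_self hg (hzero h k _))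

end Uniqueness

/-! ### Comparison of the curvatures -/

section Curvature

variable {n : ℕ} {M : Type*} [TopologicalSpace M]
  [ChartedSpace (EuclideanSpace ℝ (Fin n)) M] [IsManifold (𝓡 n) ∞ M]

theorem HasDirDeriv.dirDeriv_eq {X : SymTensor n M → SymTensor n M} {g h s : SymTensor n M}
    (H : HasDirDeriv X g h s) : dirDeriv X g h = s := by
  have hex : ∃ s, HasDirDeriv X g h s := ⟨s, H⟩
  rw [dirDeriv, dif_pos hex]
  refine SymTensor.ext fun x => ?_
  ext v w
  exact (hex.choose_spec x v w).unique (H x v w)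

theorem dirDeriv_const (l g h : SymTensor n M) : dirDeriv (fun _ => l) g h = 0 :=
  HasDirDeriv.dirDeriv_eq fun x v w => hasDerivAt_const 0 (l x v w)

theorem HasDirDeriv.add {X Y : SymTensor n M → SymTensor n M} {g h s s' : SymTensor n M}
    (H : HasDirDeriv X g h s) (H' : HasDirDeriv Y g h s') :
    HasDirDeriv (fun g' => X g' + Y g') g h (s + s') :=
  fun x v w => (H x v w).add (H' x v w)

theorem HasDirDeriv.smul {f : SymTensor n M → ℝ} {f' : ℝ} {X : SymTensor n M → SymTensor n M}
    {g h s : SymTensor n M} (Hf : HasDerivAt (fun t : ℝ => f (g + t • h)) f' 0)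
    (H : HasDirDeriv X g h s) :
    HasDirDeriv (fun g' => f g' • X g') g h (f g • s + f' • X g) := fun x v w => by
  refine (Hf.mul (H x v w)).congr_deriv ?_
  simp only [zero_smul, add_zero]
  rw [add_comm]
  rfl

theorem hasDirDeriv_const (l g h : SymTensor n M) : HasDirDeriv (fun _ => l) g h 0 :=
  fun x v w => hasDerivAt_const 0 (l x v w)

theorem hasDirDeriv_id (g h : SymTensor n M) : HasDirDeriv (fun g' => g') g h h := fun x v w => by
  have h1 := ((hasDerivAt_id (0 : ℝ)).mul_const (h x v w)).const_add (g x v w)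
  rw [one_mul] at h1
  exact h1

variable [CompactSpace M]

/-- Connections are controlled only on metrics; this suffices because a line through `g` stays in
the cone near time `0`. -/
theorem HasDirDeriv.congr_metrics {X Y : SymTensor n M → SymTensor n M} {g h s : SymTensor n M}
    (hg : g ∈ metrics n M) (H : HasDirDeriv X g h s) (hXY : ∀ g' ∈ metrics n M, Y g' = X g') :
    HasDirDeriv Y g h s := fun x v w => by
  refine (H x v w).congr_of_eventuallyEq ?_
  filter_upwards [eventually_mem_metrics hg h] with t ht
  rw [hXY _ ht]

/-- Ensures that the derivatives in the curvature are genuine and not the default value of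
`dirDeriv`. -/
theorem IsLeviCivita.exists_hasDirDeriv {G : SymTensor n M → SymTensor n M → SymTensor n M → ℝ}
    {C : SymTensor n M → SymTensor n M →ₗ[ℝ] SymTensor n M →ₗ[ℝ] SymTensor n M}
    (hC : IsLeviCivita G C) {g : SymTensor n M} (hg : g ∈ metrics n M) (h k l : SymTensor n M) :
    ∃ s, HasDirDeriv (fun g' => C g' k l) g h s := by
  obtain ⟨c, hc, hm, hev⟩ := exists_smoothCurve_eq_line hg h
  obtain ⟨s, hs⟩ := (hC.smooth c _ _ hc (isSmoothCurve_const k) (isSmoothCurve_const l) hm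
    ).exists_hasDerivAt 0
  refine ⟨s, fun x v w => (hs x v w).congr_of_eventuallyEq ?_⟩
  filter_upwards [hev] with t ht
  rw [ht]

omit [CompactSpace M] in
-- For constant fields the bracket vanishes and `∇_k l` is the Christoffel term alone.
theorem curvOp_eq {C : SymTensor n M → SymTensor n M →ₗ[ℝ] SymTensor n M →ₗ[ℝ] SymTensor n M}
    {g a b c s₁ s₂ : SymTensor n M} (h₁ : HasDirDeriv (fun g' => C g' b c) g a s₁)
    (h₂ : HasDirDeriv (fun g' => C g' a c) g b s₂) :
    curvOp C g a b c = s₁ + C g a (C g b c) - (s₂ + C g b (C g a c)) := by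
  have hcov : ∀ k l : SymTensor n M, covDeriv C (fun _ => k) (fun _ => l) = fun g' => C g' k l :=
    fun k l => funext fun g' => by simp only [covDeriv, dirDeriv_const, zero_add]
  have hbr : bracket (fun _ => a) (fun _ => b) = fun _ : SymTensor n M => 0 :=
    funext fun g' => by simp only [bracket, dirDeriv_const, sub_zero]
  rw [curvOp, curvField, hcov, hcov, hbr]
  simp only [covDeriv, h₁.dirDeriv_eq, h₂.dirDeriv_eq, dirDeriv_const, map_zero,
    LinearMap.zero_apply, add_zero, sub_zero]

variable [T2Space M] {g : SymTensor n M} (hg : g ∈ metrics n M)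

/-- The derivative of the function `g ↦ g_E(g, k)`. -/
theorem hasDerivAt_ebin_self (h k : SymTensor n M) :
    HasDerivAt (fun t : ℝ => ebin (g + t • h) (g + t • h) k)
      ((n : ℝ) / 4 * ebin g h k + ebin g g (ebinChristoffel hg h k)) 0 := by
  have h1 := (hasDerivAt_ebin hg h g k).add
    ((hasDerivAt_id (0 : ℝ)).mul (hasDerivAt_ebin hg h h k))
  refine (h1.congr_of_eventuallyEq ?_).congr_deriv ?_
  · filter_upwards [eventually_mem_metrics hg h] with t ht
    rw [ebin_add_left ht, ebin_smul_left]
    rfl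
  -- The coefficient `n/4` is `1`, from varying the argument `g`, plus `n/4 - 1`, from the
  -- Christoffel term.
  · rw [ebinChristoffel_self_right, ebin_smul_left]
    simp only [zero_smul, add_zero, one_mul, zero_mul, id_eq]
    ring

/-- The difference between the Christoffel maps of `g_p` and `g_E`. -/
def conformalTerm (p : ℝ) (g k l : SymTensor n M) : SymTensor n M :=
  (-p / (4 * vol g)) • (ebin g g k • l + ebin g g l • k + (-ebin g k l) • g)

theorem ebinPChristoffel_eq (p : ℝ) (k l : SymTensor n M) :
    ebinPChristoffel hg p k l = ebinChristoffel hg k l + conformalTerm p g k l := by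
  rw [ebinPChristoffel, conformalTerm, neg_smul, ← sub_eq_add_neg]

theorem hasDirDeriv_conformalTerm [Nonempty M] (p : ℝ) (h k l : SymTensor n M) :
    HasDirDeriv (fun g' => conformalTerm p g' k l) g h
      ((-p / (4 * vol g)) •
        (((n : ℝ) / 4 * ebin g h k + ebin g g (ebinChristoffel hg h k)) • l +
          ((n : ℝ) / 4 * ebin g h l + ebin g g (ebinChristoffel hg h l)) • k +
          ((-ebin g k l) • h +
            (-(ebin g (ebinChristoffel hg h k) l + ebin g k (ebinChristoffel hg h l))) • g)) +
        (p * ebin g g h / (8 * vol g ^ 2)) •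
          (ebin g g k • l + ebin g g l • k + (-ebin g k l) • g)) := by
  have hV := (vol_pos hg).ne'
  have hvol : HasDerivAt (fun t : ℝ => -p / (4 * vol (g + t • h)))
      (p * ebin g g h / (8 * vol g ^ 2)) 0 := by
    have h0 : 4 * vol (g + (0 : ℝ) • h) ≠ 0 := by simpa using hV
    refine ((hasDerivAt_const (0 : ℝ) (-p)).div ((hasDerivAt_vol hg h).const_mul 4) h0
      ).congr_deriv ?_
    simp only [zero_smul, add_zero]
    field_simp
    ring
  have hk := HasDirDeriv.smul (f := fun g' => ebin g' g' k) (hasDerivAt_ebin_self hg h k)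
    (hasDirDeriv_const l g h)
  have hl := HasDirDeriv.smul (f := fun g' => ebin g' g' l) (hasDerivAt_ebin_self hg h l)
    (hasDirDeriv_const k g h)
  have hkl := HasDirDeriv.smul (f := fun g' => -ebin g' k l) (hasDerivAt_ebin hg h k l).neg
    (hasDirDeriv_id g h)
  have hall := HasDirDeriv.smul (f := fun g' => -p / (4 * vol g')) hvol ((hk.add hl).add hkl)
  simp only [smul_zero, zero_add] at hall
  exact hall

include hg in
theorem curvOp_ebinP [Nonempty M] {p : ℝ}
    {CE Cp : SymTensor n M → SymTensor n M →ₗ[ℝ] SymTensor n M →ₗ[ℝ] SymTensor n M}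
    (hE : IsLeviCivita ebin CE) (hp : IsLeviCivita (ebinP p) Cp) (a b c d : SymTensor n M) :
    ebin g (curvOp Cp g a b c) d = ebin g (curvOp CE g a b c) d +
      (2 * p - p ^ 2) / 16 * kulkarniNomizu (ebin g)
        (fun h k => ebin g g h * ebin g g k / vol g ^ 2 - (n : ℝ) / (2 * vol g) * ebin g h k)
        a b c d := by
  have hV := (vol_pos hg).ne'
  have hE' : IsLeviCivita (ebinP 0) CE := by rwa [ebinP_zero]
  have hCE : ∀ g' (hg' : g' ∈ metrics n M) k l, CE g' k l = ebinChristoffel hg' k l :=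
    fun g' hg' k l => by
      rw [hE'.unique (isLeviCivita_christoffel 0) hg', christoffel_zero_eq hg']
  have hCp : ∀ g' ∈ metrics n M, ∀ k l, Cp g' k l = CE g' k l + conformalTerm p g' k l :=
    fun g' hg' k l => by
      rw [hp.unique (isLeviCivita_christoffel p) hg', christoffel_eq hg', ebinPChristoffel_eq,
        hCE g' hg']
  -- Only the existence of these derivatives of the Ebin Christoffel map matters: they occur
  -- identically in both curvatures.
  obtain ⟨s₁, h₁⟩ := hE.exists_hasDirDeriv hg a b c
  obtain ⟨s₂, h₂⟩ := hE.exists_hasDirDeriv hg b a c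
  have h₁' := (h₁.add (hasDirDeriv_conformalTerm hg p a b c)).congr_metrics hg
    (Y := fun g' => Cp g' b c) fun g' hg' => hCp g' hg' b c
  have h₂' := (h₂.add (hasDirDeriv_conformalTerm hg p b a c)).congr_metrics hg
    (Y := fun g' => Cp g' a c) fun g' hg' => hCp g' hg' a c
  rw [curvOp_eq h₁ h₂, curvOp_eq h₁' h₂']
  have hself : ∀ x, CE g x g = ((n : ℝ) / 4 - 1) • x := fun x => by
    rw [hCE g hg, ebinChristoffel_self_right]
  -- With `C(x,g)` a multiple of `x`, `(g,g) = nV` and torsion-freeness, all remaining Ebin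
  -- Christoffel terms cancel, leaving a rational identity in pairings and `V`.
  simp only [← hCE g hg, hCp g hg, conformalTerm, map_add, map_smul, hself, ebin_add_left hg,
    ebin_sub_left hg, ebin_smul_left, ebin_add_right hg, ebin_smul_right, ebin_self_self hg,
    hE.torsion_free g hg b a, kulkarniNomizu]
  rw [ebin_comm g b a, ebin_comm g a g, ebin_comm g b g]
  field_simp
  ring

include hg in
/-- The curvature tensor of `g_p` in terms of that of the Ebin metric. -/
theorem curv_ebinP {p : ℝ}
    {CE Cp : SymTensor n M → SymTensor n M →ₗ[ℝ] SymTensor n M →ₗ[ℝ] SymTensor n M}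
    (hE : IsLeviCivita ebin CE) (hp : IsLeviCivita (ebinP p) Cp) (a b c d : SymTensor n M) :
    curv (ebinP p) Cp g a b c d = vol g ^ (-p) * curv ebin CE g a b c d +
      (2 * p - p ^ 2) / 16 * kulkarniNomizu (ebinP p g)
        (fun h k => vol g ^ (2 * p - 2) * (flatP p g h * flatP p g k) -
          (n : ℝ) / 2 * vol g ^ (p - 1) * ebinP p g h k) a b c d := by
  cases isEmpty_or_nonempty M
  · have h0 : ∀ k l : SymTensor n M, ebin g k l = 0 := fun k l => by
      rw [k.eq_zero_of_isEmpty, ← zero_smul ℝ (0 : SymTensor n M), ebin_smul_left, zero_mul]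
    simp [curv, kulkarniNomizu, ebinP, h0]
  have hV := vol_pos hg
  have hP := Real.rpow_pos_of_pos hV p
  -- Each `g_p` pairing carries a factor `V^{-p}`; these powers of `V` convert the bracketed form to
  -- its `g_E` expression.
  have h1 : vol g ^ (2 * p - 2) = (vol g ^ p) ^ 2 / vol g ^ 2 := by
    rw [Real.rpow_sub hV, two_mul, Real.rpow_add hV, sq, Real.rpow_two]
  have h2 : vol g ^ (p - 1) = vol g ^ p / vol g := Real.rpow_sub_one hV.ne' p
  rw [curv, curv, ebinP, curvOp_ebinP hg hE hp]
  simp only [kulkarniNomizu, flatP, ebinP, h1, h2, Real.rpow_neg hV.le]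
  field_simp

end Curvature

end SpaceOfMetrics

end

theorem proposition3p7 (n : ℕ) (M : Type*) [TopologicalSpace M]
    [ChartedSpace (EuclideanSpace ℝ (Fin n)) M] [IsManifold (𝓡 n) ∞ M]
    [CompactSpace M] [T2Space M] (p : ℝ) :
    -- the Levi-Civita connections of the Ebin metric and of `g_p` exist
    (∃ CE, IsLeviCivita (n := n) (M := M) ebin CE) ∧
    (∃ Cp, IsLeviCivita (n := n) (M := M)
      (ebinP p) Cp) ∧
    ∀ CE Cp : SymTensor n M → SymTensor n M →ₗ[ℝ]
        SymTensor n M →ₗ[ℝ] SymTensor n M,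
      IsLeviCivita ebin CE →
      IsLeviCivita (ebinP p) Cp →
      ∀ g ∈ metrics n M,
        -- the curvature tensor of `g_p`
        (∀ a b c d : SymTensor n M,
          curv (ebinP p) Cp g a b c d =
            vol g ^ (-p) *
                curv ebin CE g a b c d
              + (2 * p - p ^ 2) / 16 *
                kulkarniNomizu (ebinP p g)
                  (fun h k =>
                    vol g ^ (2 * p - 2) *
                        (flatP p g h * flatP p g k)
                      - (n : ℝ) / 2 * vol g ^ (p - 1) *
                        ebinP p g h k)
                  a b c d) ∧
        -- the sectional curvature of `g_p` on the plane of an orthonormal pair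
        (∀ h k : SymTensor n M,
          ebinP p g h h = 1 →
          ebinP p g k k = 1 →
          ebinP p g h k = 0 →
          planeCurv (ebinP p) Cp g h k =
              sec (ebinP p) Cp g h k ∧
          sec (ebinP p) Cp g h k =
            vol g ^ (-p) *
                sec ebin CE g h k
              - (2 * p - p ^ 2) / 16 *
                (vol g ^ (2 * p - 2) *
                    ebinP p g g k ^ 2
                  + vol g ^ (2 * p - 2) *
                    ebinP p g g h ^ 2
                  - (n : ℝ) * vol g ^ (p - 1))) := by
  refine ⟨⟨christoffel n M 0, ?_⟩, ⟨christoffel n M p, isLeviCivita_christoffel p⟩,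
    fun CE Cp hE hp g hg => ?_⟩
  · rw [← ebinP_zero]
    exact isLeviCivita_christoffel 0
  refine ⟨fun a b c d => curv_ebinP hg hE hp a b c d, fun h k hh hk hhk => ⟨?_, ?_⟩⟩
  · rw [planeCurv, hh, hk, hhk]
    norm_num
  · have hkh : ebinP p g k h = 0 := by
      rw [← hhk, ebinP, ebinP, ebin_comm]
    rw [sec, sec, curv_ebinP hg hE hp]
    -- On `(h,k,k,h)` orthonormality reduces the Kulkarni–Nomizu product with `B` to `-(B(h,h) +
    -- B(k,k))`; the two terms with `n/2` add up to `n`.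
    simp only [kulkarniNomizu, flatP, hh, hk, hhk, hkh]
    ring
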